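/- Let $U\subseteq\mathbb C$ be a nonempty connected open set, and let $\mathfrak d^1_0(U)$ be the Lie algebra, under the commutator, of all operators $$T=f(z)\,\partial_z+g(z)\,\theta\partial_\theta+h(z),\qquad f,g,h \text{ analytic on } U,$$ acting on functions $u(z)+v(z)\theta$ of $z\in U$ and one Grassmann variable $\theta$ ($\theta^2=0$). Let $\mathfrak l\subset\mathfrak d^1_0(U)$ be a finite-dimensional complex Lie subalgebra. Call $p\in U$ regular if either $f=0$ for all $T\in\mathfrak l$, or $f(p)\neq0$ for some $T\in\mathfrak l$. Then the regular points are dense in $U$, and every regular point $p$ has an open neighbourhood $V\subseteq U$ on which $\mathfrak l$ is equivalent to one of the Lie algebras $\mathfrak l^0,\dots,\mathfrak l^3$ below. Here equivalence means that there are a biholomorphic map $\varphi$ of $V$ onto an open set $W\subseteq\mathbb C$ and non-vanishing analytic functions $\beta,\alpha$ on $V$ such that the change of variables $\bar z=\varphi(z)$, $\bar\theta=\beta(z)\theta$ followed by the gauge transformation $T\mapsto\alpha\,T\,\alpha^{-1}$ carries the restriction of $\mathfrak l$ to $V$ exactly onto the listed space of operators on $W$ (whose variables are again written $z,\theta$).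 Angle brackets denote complex linear spans. (i) $\mathfrak l^0=\langle g_i(z)\theta\partial_\theta+h_i(z)\mid 1\le i\le m\rangle$, $m\ge0$, where $g_i,h_i$ are analytic on $W$ and the operators are linearly independent. (ii) $\mathfrak l^1=\langle\partial_z\rangle+\mathfrak m(\mathfrak a_0,M)$, where $M\subset\mathbb C$ is finite and $\mathfrak m(\mathfrak a_0,M)$ is the finite-dimensional, $\mathrm{ad}\,\partial_z$-invariant space spanned, for $\mu\in M$, by $$z^k e^{\mu z}\theta\partial_\theta\ (0\le k\le m_\mu),\qquad z^k e^{\mu z}\ (0\le k\le n_\mu),\qquad e^{\mu z}\Big(z^{m_\mu+k}\theta\partial_\theta+z^{n_\mu}\sum_{j=1}^k c^{\mu,k}_j z^j\Big)\ (1\le k\le r_\mu),$$ with integers $m_\mu,n_\mu\ge-1$, $r_\mu\ge0$ and $$c^{\mu,k}_j=\frac{(m_\mu+k)!\,(n_\mu+1)!}{(n_\mu+j)!\,(m_\mu+k-j+1)!}\,c^{\mu,k-j+1},\qquad c^{\mu,1},\dots,c^{\mu,r_\mu}\in\mathbb C,\quad c^{\mu,1}\ne0 \text{ if } r_\mu\ge1.$$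 (iii) $\mathfrak l^2=\langle\partial_z,\ z\partial_z+\alpha\theta\partial_\theta+\beta\rangle+\mathfrak m_0(\mathfrak a_0)$ with $\alpha,\beta\in\mathbb C$, where $$\mathfrak m_0(\mathfrak a_0)=\langle z^i\theta\partial_\theta,\ z^j,\ z^k(z^m\theta\partial_\theta+c_kz^n)\mid 0\le i\le m,\ 0\le j\le n,\ 1\le k\le r\rangle,\qquad c_k=\frac{(m+k)!\,(n+1)!}{(n+k)!\,(m+1)!}\,c,$$ with integers $m,n\ge-1$, $r\ge0$ and a complex number $c\neq0$, and with $m=n$ if $r\ge1$. (iv) $\mathfrak l^3$ is spanned by $\partial_z$, $z\partial_z+\alpha\theta\partial_\theta+\beta$, $z^2\partial_z+2\alpha z\theta\partial_\theta+2\beta z$ and a (possibly empty) subset of $\{\theta\partial_\theta+\gamma,\ 1\}$, with $\alpha,\beta,\gamma\in\mathbb C$. -/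

import Mathlib

open TopologicalSpace

noncomputable section

namespace EvenOps

/-- Extension by zero of a function on an open set; only its values on `U` matter. -/
def ext0 {U : Opens ℂ} (f : U → ℂ) : ℂ → ℂ := Function.extend Subtype.val f 0

theorem ext0_apply {U : Opens ℂ} (f : U → ℂ) (z : U) : ext0 f z = f z :=
  Subtype.val_injective.extend_apply f 0 z

theorem ext0_eventuallyEq {U : Opens ℂ} (f : U → ℂ) (F : ℂ → ℂ) (h : ∀ z : U, f z = F z)
    (z : U) : F =ᶠ[nhds (z : ℂ)] ext0 f := by
  filter_upwards [U.isOpen.mem_nhds z.2] with w hw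
  rw [ext0_apply f ⟨w, hw⟩, h]

/-- A function on `U` which agrees on `U` with a function analytic at each point of `U`
is analytic. -/
theorem analyticOnNhd_ext0 {U : Opens ℂ} {f : U → ℂ} {F : ℂ → ℂ}
    (hF : AnalyticOnNhd ℂ F U) (h : ∀ z : U, f z = F z) : AnalyticOnNhd ℂ (ext0 f) U :=
  fun z hz => (hF z hz).congr (ext0_eventuallyEq f F h ⟨z, hz⟩)

/-- The algebra of analytic functions on the open set `U ⊆ ℂ`. -/
def Hol (U : Opens ℂ) : Subalgebra ℂ (U → ℂ) where
  carrier := {f | AnalyticOnNhd ℂ (ext0 f) U}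
  mul_mem' {f g} hf hg := analyticOnNhd_ext0 (hf.mul hg) fun z => by simp [ext0_apply]
  add_mem' {f g} hf hg := analyticOnNhd_ext0 (hf.add hg) fun z => by simp [ext0_apply]
  algebraMap_mem' c := analyticOnNhd_ext0 (F := fun _ => c) analyticOnNhd_const fun _ => rfl

/-- Restriction to `U` of a function analytic at each point of `U`. -/
def Hol.mk {U : Opens ℂ} (F : ℂ → ℂ) (hF : AnalyticOnNhd ℂ F U) : Hol U :=
  ⟨fun z => F z, analyticOnNhd_ext0 hF fun _ => rfl⟩

/-- The derivation `d/dz` of the algebra of analytic functions on `U`. -/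
def ddz (U : Opens ℂ) : Derivation ℂ (Hol U) (Hol U) :=
  Derivation.mk'
    { toFun := fun f => Hol.mk (deriv (ext0 f.1)) (AnalyticOnNhd.deriv f.2)
      map_add' := fun f g => by
        ext z
        have h := ext0_eventuallyEq (f.1 + g.1) (ext0 f.1 + ext0 g.1)
          (fun w => by simp [ext0_apply]) z
        change deriv (ext0 (f.1 + g.1)) z = deriv (ext0 f.1) z + deriv (ext0 g.1) z
        rw [← h.deriv_eq, deriv_add (f.2 z z.2).differentiableAt (g.2 z z.2).differentiableAt]
      map_smul' := fun c f => by
        ext z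
        have h := ext0_eventuallyEq (c • f.1) (c • ext0 f.1)
          (fun w => by simp [ext0_apply]) z
        change deriv (ext0 (c • f.1)) z = c • deriv (ext0 f.1) z
        rw [← h.deriv_eq, deriv_const_smul _ (f.2 z z.2).differentiableAt] }
    (fun f g => by
      ext z
      have h := ext0_eventuallyEq (f.1 * g.1) (ext0 f.1 * ext0 g.1)
        (fun w => by simp [ext0_apply]) z
      change deriv (ext0 (f.1 * g.1)) z
        = f.1 z * deriv (ext0 g.1) z + g.1 z * deriv (ext0 f.1) z
      rw [← h.deriv_eq, deriv_mul (f.2 z z.2).differentiableAt (g.2 z z.2).differentiableAt,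
        ext0_apply, ext0_apply]
      ring)

/-- Restriction of analytic functions to a smaller open set. -/
def res {U V : Opens ℂ} (hVU : V ≤ U) (f : Hol U) : Hol V :=
  Hol.mk (ext0 f.1) fun z hz => f.2 z (hVU hz)

/-- Analytic functions of `z ∈ U` and one Grassmann variable `θ`:
the pair `(u, v)` stands for `u(z) + v(z) θ`. -/
abbrev SFun (U : Opens ℂ) : Type := Hol U × Hol U

/-- Multiplication by the function `f(z)`. -/
def mulBy {U : Opens ℂ} (f : Hol U) : Module.End ℂ (SFun U) :=
  (LinearMap.mulLeft ℂ f).prodMap (LinearMap.mulLeft ℂ f)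

/-- The operator `∂_z`. -/
def dz (U : Opens ℂ) : Module.End ℂ (SFun U) :=
  (ddz U : Hol U →ₗ[ℂ] Hol U).prodMap (ddz U : Hol U →ₗ[ℂ] Hol U)

/-- Multiplication by `θ`: `u + v θ ↦ u θ`. -/
def mulTheta (U : Opens ℂ) : Module.End ℂ (SFun U) :=
  (0 : SFun U →ₗ[ℂ] Hol U).prod (LinearMap.fst ℂ (Hol U) (Hol U))

/-- The operator `∂_θ`: `u + v θ ↦ v`. -/
def dTheta (U : Opens ℂ) : Module.End ℂ (SFun U) :=
  (LinearMap.snd ℂ (Hol U) (Hol U)).prod 0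

/-- The even first-order operator `f(z) ∂_z + g(z) θ ∂_θ + h(z)`; products of operators are
compositions. -/
def evenOp {U : Opens ℂ} (f g h : Hol U) : Module.End ℂ (SFun U) :=
  mulBy f * dz U + mulBy g * (mulTheta U * dTheta U) + mulBy h

theorem evenOp_apply {U : Opens ℂ} (f g h : Hol U) (F : SFun U) :
    evenOp f g h F = (f * ddz U F.1 + h * F.1, f * ddz U F.2 + g * F.2 + h * F.2) := by
  simp [evenOp, mulBy, dz, mulTheta, dTheta]

theorem evenOp_lie {U : Opens ℂ} (f g h f' g' h' : Hol U) :
    ⁅evenOp f g h, evenOp f' g' h'⁆ =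
      evenOp (f * ddz U f' - f' * ddz U f) (f * ddz U g' - f' * ddz U g)
        (f * ddz U h' - f' * ddz U h) := by
  refine LinearMap.ext fun F => ?_
  rw [Ring.lie_def, LinearMap.sub_apply, Module.End.mul_apply, Module.End.mul_apply]
  simp only [evenOp_apply, map_add, Derivation.leibniz, smul_eq_mul]
  refine Prod.ext ?_ ?_
  · simp only [Prod.fst_sub]; ring
  · simp only [Prod.snd_sub]; ring

/-- The commutator of operators. -/
instance instLieRingEnd (U : Opens ℂ) : LieRing (Module.End ℂ (SFun U)) :=
  LieRing.ofAssociativeRing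

instance instLieAlgebraEnd (U : Opens ℂ) : LieAlgebra ℂ (Module.End ℂ (SFun U)) :=
  LieAlgebra.ofAssociativeAlgebra

/-- The Lie algebra (under the commutator) of all even first-order operators
`f(z) ∂_z + g(z) θ ∂_θ + h(z)` with coefficients analytic on `U`. -/
def d10 (U : Opens ℂ) : LieSubalgebra ℂ (Module.End ℂ (SFun U)) where
  carrier := {T | ∃ f g h : Hol U, T = evenOp f g h}
  zero_mem' := ⟨0, 0, 0, LinearMap.ext fun F => by simp [evenOp_apply]; rfl⟩
  add_mem' := by
    rintro _ _ ⟨f, g, h, rfl⟩ ⟨f', g', h', rfl⟩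
    refine ⟨f + f', g + g', h + h', LinearMap.ext fun F => ?_⟩
    simp only [LinearMap.add_apply, evenOp_apply, Prod.mk_add_mk]
    refine Prod.ext ?_ ?_ <;> dsimp only <;> ring
  smul_mem' := by
    rintro c _ ⟨f, g, h, rfl⟩
    refine ⟨c • f, c • g, c • h, LinearMap.ext fun F => ?_⟩
    simp only [LinearMap.smul_apply, evenOp_apply, Prod.smul_mk, smul_add, smul_mul_assoc]
  lie_mem' := by
    rintro _ _ ⟨f, g, h, rfl⟩ ⟨f', g', h', rfl⟩
    exact ⟨_, _, _, evenOp_lie f g h f' g' h'⟩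

/-! ### Equivalence transformations -/

/-- A biholomorphic change of variable `z̄ = φ(z)` from `V` onto `W`, a change of the odd variable
`θ̄ = β(z) θ`, and a gauge factor `α(z)`. A unit of the algebra of analytic functions is the same
as a non-vanishing analytic function. -/
structure Transf (V W : Opens ℂ) where
  φ : Hol V
  mapsTo : ∀ z : V, φ.1 z ∈ W
  bijective : Function.Bijective fun z : V => (⟨φ.1 z, mapsTo z⟩ : W)
  deriv_ne : ∀ z : V, (ddz V φ).1 z ≠ 0
  β : (Hol V)ˣ
  α : (Hol V)ˣ

/-- The function `u(φ(z))`. -/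
def Transf.comp {V W : Opens ℂ} (Φ : Transf V W) (u : Hol W) : Hol V :=
  ⟨fun z => u.1 ⟨Φ.φ.1 z, Φ.mapsTo z⟩,
    analyticOnNhd_ext0 (F := ext0 u.1 ∘ ext0 Φ.φ.1)
      (fun z hz => by
        have hz' : ext0 Φ.φ.1 z = Φ.φ.1 ⟨z, hz⟩ := ext0_apply Φ.φ.1 ⟨z, hz⟩
        refine AnalyticAt.comp ?_ (Φ.φ.2 z hz)
        rw [hz']
        exact u.2 _ (Φ.mapsTo ⟨z, hz⟩))
      (fun z => by
        simp only [Function.comp_apply, ext0_apply]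
        exact (ext0_apply u.1 ⟨Φ.φ.1 z, Φ.mapsTo z⟩).symm)⟩

/-- A function `F̄(z̄, θ̄)` in the new variables comes from the function
`F(z, θ) = α(z)⁻¹ F̄(φ(z), β(z) θ)` in the old ones, that is `F̄ = α F`. -/
def Transf.pull {V W : Opens ℂ} (Φ : Transf V W) (F : SFun W) : SFun V :=
  (((Φ.α⁻¹ : (Hol V)ˣ) : Hol V) * Φ.comp F.1,
    ((Φ.α⁻¹ : (Hol V)ˣ) : Hol V) * (Φ.β : Hol V) * Φ.comp F.2)

/-- `T'` is the operator `T` written in the new variables and gauge: `T' = α T α⁻¹`, that is,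
`T' F̄` corresponds to `T F` whenever `F̄` corresponds to `F`. -/
def Transf.Carries {V W : Opens ℂ} (Φ : Transf V W) (T : Module.End ℂ (SFun V))
    (T' : Module.End ℂ (SFun W)) : Prop :=
  ∀ F : SFun W, Φ.pull (T' F) = T (Φ.pull F)

/-- The space `N` of operators on `W` consists exactly of the transforms under `Φ` of the
restrictions to `V` of the elements of the algebra `l` of even operators on `U`. -/
def Transf.CarriesAlgebra {U V W : Opens ℂ} (Φ : Transf V W) (hVU : V ≤ U)
    (l : LieSubalgebra ℂ (Module.End ℂ (SFun U)))
    (N : Submodule ℂ (Module.End ℂ (SFun W))) : Prop :=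
  ∀ T' : Module.End ℂ (SFun W), T' ∈ N ↔
    ∃ f g h : Hol U, evenOp f g h ∈ l ∧
      Φ.Carries (evenOp (res hVU f) (res hVU g) (res hVU h)) T'

/-- The point `p` is regular if it is not a common zero of the vector field parts `f ∂_z` of the
elements of `l`, or if all these vector field parts are identically zero. -/
def IsRegularPoint {U : Opens ℂ} (l : LieSubalgebra ℂ (Module.End ℂ (SFun U))) (p : U) : Prop :=
  (∀ f g h : Hol U, evenOp f g h ∈ l → f = 0) ∨
    ∃ f g h : Hol U, evenOp f g h ∈ l ∧ f.1 p ≠ 0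

/-! ### The canonical forms -/

/-- The function `z ^ k * exp (μ z)`. -/
def expMon (W : Opens ℂ) (μ : ℂ) (k : ℕ) : Hol W :=
  Hol.mk (fun z => z ^ k * Complex.exp (μ * z)) fun z _ => by fun_prop

/-- The function `z ^ k`. -/
def mon (W : Opens ℂ) (k : ℕ) : Hol W := Hol.mk (fun z => z ^ k) fun z _ => by fun_prop

/-- The multiplicative operator `g(z) θ ∂_θ + h(z)`. These operators form the space
`𝓜 ⊗ 𝔞₀`, where `𝓜` is the space of analytic functions and `𝔞₀ = ⟨θ ∂_θ, 1⟩`. -/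
def aOp {W : Opens ℂ} (g h : Hol W) : Module.End ℂ (SFun W) := evenOp 0 g h

/-- An `𝔞₀`-translation bimodule: a finite-dimensional space of operators `g θ ∂_θ + h`
which is invariant under (the adjoint action of) `∂_z`. -/
def IsTranslationBimodule {W : Opens ℂ} (N : Submodule ℂ (Module.End ℂ (SFun W))) : Prop :=
  FiniteDimensional ℂ N ∧ (∀ T ∈ N, ∃ g h : Hol W, T = aOp g h) ∧ ∀ T ∈ N, ⁅dz W, T⁆ ∈ N

/-- The coefficient `c^{μ,k}_j` in terms of the free constants `c^{μ,1}, c^{μ,2}, …`. Everything is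
counted from zero: `a = m_μ + 1`, `b = n_μ + 1`, `k` and `j` stand for `k - 1` and `j - 1`, and
`c l` is `c^{μ,l+1}`. -/
def mixedCoeff (a b : ℕ) (c : ℕ → ℂ) (k j : ℕ) : ℂ :=
  ((a + k).factorial * b.factorial : ℂ) / ((b + j).factorial * (a + k - j).factorial) * c (k - j)

/-- The space `𝔪(𝔞₀, M)` with `v₁ = θ ∂_θ`, `v₂ = 1`, where `a μ = m_μ + 1`, `b μ = n_μ + 1`. It is
spanned, for `μ ∈ M`, by `z^k e^{μz} v₁` (`0 ≤ k ≤ m_μ`), by `z^k e^{μz} v₂` (`0 ≤ k ≤ n_μ`), and by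
`e^{μz} (z^{m_μ+k} v₁ + z^{n_μ} ∑_{j=1}^k c^{μ,k}_j z^j v₂)` (`1 ≤ k ≤ r_μ`). -/
def bimodule (W : Opens ℂ) (M : Finset ℂ) (a b r : ℂ → ℕ) (c : ℂ → ℕ → ℂ) :
    Submodule ℂ (Module.End ℂ (SFun W)) :=
  Submodule.span ℂ
    ({T | ∃ μ ∈ M, ∃ k < a μ, T = aOp (expMon W μ k) 0} ∪
     {T | ∃ μ ∈ M, ∃ k < b μ, T = aOp 0 (expMon W μ k)} ∪
     {T | ∃ μ ∈ M, ∃ k < r μ, T = aOp (expMon W μ (a μ + k))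
        (∑ j ∈ Finset.range (k + 1),
          mixedCoeff (a μ) (b μ) (c μ) k j • expMon W μ (b μ + j))})

/-- The space `𝔪₀(𝔞₀)`, where `a = m + 1`, `b = n + 1`: the span of `z^i θ∂_θ` (`0 ≤ i ≤ m`),
`z^j` (`0 ≤ j ≤ n`) and `z^k (z^m θ∂_θ + c_k z^n)` (`1 ≤ k ≤ r`), with
`c_k = (m+k)! (n+1)! / ((n+k)! (m+1)!) c`. -/
def bimodule₀ (W : Opens ℂ) (a b r : ℕ) (c : ℂ) : Submodule ℂ (Module.End ℂ (SFun W)) :=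
  Submodule.span ℂ
    ({T | ∃ i < a, T = aOp (mon W i) 0} ∪
     {T | ∃ j < b, T = aOp 0 (mon W j)} ∪
     {T | ∃ k < r, T = aOp (mon W (a + k))
        ((((a + k).factorial * b.factorial : ℂ) / ((b + k).factorial * a.factorial) * c) •
          mon W (b + k))})

/-- The family `𝔩⁰`. -/
def IsForm0 {W : Opens ℂ} (N : Submodule ℂ (Module.End ℂ (SFun W))) : Prop :=
  ∃ (m : ℕ) (g h : Fin m → Hol W), LinearIndependent ℂ (fun i => aOp (g i) (h i)) ∧
    N = Submodule.span ℂ (Set.range fun i => aOp (g i) (h i))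

/-- The family `𝔩¹ = ⟨∂_z ; 𝔪(𝔞₀, M)⟩`. -/
def IsForm1 {W : Opens ℂ} (N : Submodule ℂ (Module.End ℂ (SFun W))) : Prop :=
  ∃ (M : Finset ℂ) (a b r : ℂ → ℕ) (c : ℂ → ℕ → ℂ),
    (∀ μ ∈ M, 0 < r μ → c μ 0 ≠ 0) ∧
    IsTranslationBimodule (bimodule W M a b r c) ∧
    N = Submodule.span ℂ {dz W} ⊔ bimodule W M a b r c

/-- The family `𝔩² = ⟨∂_z, z∂_z + αθ∂_θ + β ; 𝔪₀(𝔞₀)⟩`, with `m = n` if mixed generators occur. -/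
def IsForm2 {W : Opens ℂ} (N : Submodule ℂ (Module.End ℂ (SFun W))) : Prop :=
  ∃ (α β c : ℂ) (a b r : ℕ), c ≠ 0 ∧ (1 ≤ r → a = b) ∧
    N = Submodule.span ℂ {dz W, evenOp (mon W 1) (α • 1) (β • 1)} ⊔ bimodule₀ W a b r c

/-- The family `𝔩³ = ⟨∂_z, z∂_z + αθ∂_θ + β, z²∂_z + 2αzθ∂_θ + 2βz ; θ∂_θ + γ, 1⟩`; each of the last
two generators may be present or absent. -/
def IsForm3 {W : Opens ℂ} (N : Submodule ℂ (Module.End ℂ (SFun W))) : Prop :=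
  ∃ (α β γ : ℂ) (S : Set (Module.End ℂ (SFun W))), S ⊆ {aOp 1 (γ • 1), aOp 0 1} ∧
    N = Submodule.span ℂ
      ({dz W, evenOp (mon W 1) (α • 1) (β • 1),
        evenOp (mon W 2) ((2 * α) • mon W 1) ((2 * β) • mon W 1)} ∪ S)

end EvenOps

end

noncomputable section

namespace EvenOps

open Polynomial

variable {U V W : Opens ℂ}

/-! ### Analytic functions -/

/-! Density is the identity theorem: a nonzero vector field part cannot vanish on an open subset of
a connected set (`dense_isRegularPoint`). If all vector field parts vanish, a basis of the algebra
is already the first normal form.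

Otherwise the vector field parts form a finite-dimensional Lie algebra `F` with an element `f₀` not
vanishing at `p`. If `F` is not a line, an eigenvector of `ad f₀` on `F` modulo `f₀` yields a
nonvanishing `f₁ ∈ F` and a coordinate `φ` with `f₁ ∂_z = ∂_φ` and `φ ∂_φ ∈ F`
(`exists_straightening`, `exists_transf_straightening`). In that coordinate `F` consists of
polynomials, and brackets of the two highest powers bound the degree by two (`fst_mem_span`). So `F`
is spanned by `1`, by `1, z` or by `1, z, z²`.

The multiplicative tails are then removed. Rescaling `θ` and conjugating by a function add `f ξ` to
`(g, h)`, with `ξ` given by logarithmic derivatives, which clears the tail of `∂_z`. When `z ∂_z` is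
present, its tail can be made constant at the same time, because `a ↦ (z a)'` is invertible on the
multiplicative part (`exists_gauge`).

What remains is the multiplicative part, a finite-dimensional `d/dz`-invariant space of pairs of
functions. Its generalized eigenspaces have the form `e^{μz}` times pairs of polynomials, and the
`d/dX`-invariant spaces of such pairs are described by three integers and some constants
(`exists_eq_span_blockGens`). Invariance under `z d/dz` excludes `μ ≠ 0` and makes the space graded;
invariance under `z² d/dz` leaves only constants.

All of this is done on triples of coefficients, which determine the operator (`evenHom_injective`),
and is translated back by `carriesAlgebra_withFactors`. -/

theorem Hol.ext' {f g : Hol U} (h : ∀ z : U, f.1 z = g.1 z) : f = g :=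
  Subtype.ext (funext h)

theorem hasDerivAt_ext0 (f : Hol U) (z : U) :
    HasDerivAt (ext0 f.1) ((ddz U f).1 z) z :=
  (f.2 z z.2).differentiableAt.hasDerivAt

theorem ddz_eq_of_hasDerivAt {f g : Hol U} {F : ℂ → ℂ} (hF : ∀ z : U, f.1 z = F z)
    (h : ∀ z : U, HasDerivAt F (g.1 z) z) : ddz U f = g :=
  Hol.ext' fun z => (hasDerivAt_ext0 f z).unique
    ((h z).congr_of_eventuallyEq (ext0_eventuallyEq f.1 F hF z).symm)

theorem res_apply (hVU : V ≤ U) (f : Hol U) (z : V) : (res hVU f).1 z = f.1 ⟨z, hVU z.2⟩ :=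
  ext0_apply f.1 ⟨z, hVU z.2⟩

/-- Restriction as a homomorphism of algebras. -/
def resHom (hVU : V ≤ U) : Hol U →ₐ[ℂ] Hol V where
  toFun := res hVU
  map_one' := Hol.ext' fun z => by rw [res_apply]; rfl
  map_mul' f g := Hol.ext' fun z => by
    change _ = (res hVU f).1 z * (res hVU g).1 z
    simp only [res_apply]; rfl
  map_zero' := Hol.ext' fun z => by rw [res_apply]; rfl
  map_add' f g := Hol.ext' fun z => by
    change _ = (res hVU f).1 z + (res hVU g).1 z
    simp only [res_apply]; rfl
  commutes' c := Hol.ext' fun z => by rw [res_apply]; rfl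

@[simp]
theorem resHom_apply (hVU : V ≤ U) (f : Hol U) : resHom hVU f = res hVU f := rfl

theorem res_res (hVU : V ≤ U) (hWV : W ≤ V) (f : Hol U) :
    res hWV (res hVU f) = res (hWV.trans hVU) f :=
  Hol.ext' fun z => by simp only [res_apply]

theorem ddz_res (hVU : V ≤ U) (f : Hol U) : ddz V (res hVU f) = res hVU (ddz U f) :=
  ddz_eq_of_hasDerivAt (F := ext0 f.1) (fun z => rfl) fun z => by
    rw [res_apply]; exact hasDerivAt_ext0 f ⟨z, hVU z.2⟩

/-- On a connected open set, a function with vanishing derivative is constant. -/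
theorem exists_eq_smul_one_of_ddz_eq_zero (hW : IsPreconnected (W : Set ℂ)) {f : Hol W}
    (hf : ddz W f = 0) : ∃ c : ℂ, f = c • (1 : Hol W) := by
  obtain ⟨c, hc⟩ := W.isOpen.exists_is_const_of_deriv_eq_zero hW
    (fun z hz => (f.2 z hz).differentiableAt.differentiableWithinAt)
    (fun z hz => congrFun (congrArg Subtype.val hf) ⟨z, hz⟩)
  refine ⟨c, Hol.ext' fun z => ?_⟩
  rw [← ext0_apply f.1 z, hc z z.2]
  simp

/-- Every analytic function on `W` has a primitive. -/
def HasPrimitives (W : Opens ℂ) : Prop := ∀ f : Hol W, ∃ F : Hol W, ddz W F = f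

/-- Cauchy's theorem on a disc. Primitives supply the straightening coordinate as well as the
factors `β` and `α`, which is why sources and targets are shrunk to balls. -/
theorem hasPrimitives_of_ball {c : ℂ} {r : ℝ} (hW : (W : Set ℂ) = Metric.ball c r) :
    HasPrimitives W := by
  intro f
  have hd : DifferentiableOn ℂ (ext0 f.1) (Metric.ball c r) := by
    rw [← hW]; exact fun z hz => (f.2 z hz).differentiableAt.differentiableWithinAt
  obtain ⟨F, hF⟩ := hd.isExactOn_ball
  rw [← hW] at hF
  have hFa : AnalyticOnNhd ℂ F W :=
    DifferentiableOn.analyticOnNhd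
      (fun z hz => (hF z hz).differentiableAt.differentiableWithinAt) W.isOpen
  refine ⟨Hol.mk F hFa, ddz_eq_of_hasDerivAt (F := F) (fun _ => rfl) fun z => ?_⟩
  rw [← ext0_apply f.1 z]
  exact hF z z.2

theorem isUnit_of_forall_ne_zero {f : Hol U} (hf : ∀ z : U, f.1 z ≠ 0) : IsUnit f := by
  refine IsUnit.of_mul_eq_one (⟨fun z => (f.1 z)⁻¹, ?_⟩ : Hol U) (Hol.ext' fun z => ?_)
  · refine analyticOnNhd_ext0 (F := fun z => (ext0 f.1 z)⁻¹) (fun z hz => ?_) fun z => ?_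
    · refine (f.2 z hz).inv ?_
      rw [ext0_apply f.1 ⟨z, hz⟩]
      exact hf _
    · rw [ext0_apply]
  · exact mul_inv_cancel₀ (hf z)

theorem apply_ne_zero_of_isUnit {f : Hol U} (hf : IsUnit f) (z : U) : f.1 z ≠ 0 := by
  obtain ⟨g, hg⟩ := hf.exists_right_inv
  intro h
  have : f.1 z * g.1 z = 1 := congrFun (congrArg Subtype.val hg) z
  simp [h] at this

/-- The exponential of an analytic function. -/
def Hol.exp (f : Hol U) : Hol U :=
  Hol.mk (fun z => Complex.exp (ext0 f.1 z)) fun z hz => (f.2 z hz).cexp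

theorem isUnit_exp (f : Hol U) : IsUnit (Hol.exp f) :=
  isUnit_of_forall_ne_zero fun _ => Complex.exp_ne_zero _

theorem ddz_exp (f : Hol U) : ddz U (Hol.exp f) = ddz U f * Hol.exp f :=
  ddz_eq_of_hasDerivAt (F := fun z => Complex.exp (ext0 f.1 z)) (fun _ => rfl) fun z => by
    have := (hasDerivAt_ext0 f z).cexp
    rw [mul_comm] at this
    exact this

theorem ddz_mon_one (W : Opens ℂ) : ddz W (mon W 1) = 1 :=
  ddz_eq_of_hasDerivAt (F := fun z => z ^ 1) (fun _ => rfl) fun z => by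
    simp only [pow_one]; exact hasDerivAt_id' (z : ℂ)

theorem mon_eq_pow (W : Opens ℂ) (k : ℕ) : mon W k = mon W 1 ^ k :=
  Hol.ext' fun z => by
    change (z : ℂ) ^ k = ((z : ℂ) ^ 1) ^ k
    rw [pow_one]

/-- The function `exp (μ z)`. -/
def expHol (W : Opens ℂ) (μ : ℂ) : Hol W := Hol.exp (μ • mon W 1)

theorem ddz_expHol (W : Opens ℂ) (μ : ℂ) : ddz W (expHol W μ) = μ • expHol W μ := by
  rw [expHol, ddz_exp, Derivation.map_smul, ddz_mon_one, smul_mul_assoc, one_mul]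

theorem expHol_zero (W : Opens ℂ) : expHol W 0 = 1 :=
  Hol.ext' fun z => by
    change Complex.exp (ext0 ((0 : ℂ) • mon W 1).1 z) = 1
    rw [ext0_apply]; simp

theorem expMon_eq (W : Opens ℂ) (μ : ℂ) (k : ℕ) :
    expMon W μ k = mon W k * expHol W μ :=
  Hol.ext' fun z => by
    change (z : ℂ) ^ k * Complex.exp (μ * z) =
      (z : ℂ) ^ k * Complex.exp (ext0 (μ • mon W 1).1 z)
    rw [ext0_apply]
    change _ = (z : ℂ) ^ k * Complex.exp (μ * (z : ℂ) ^ 1)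
    rw [pow_one]

/-- Polynomials as analytic functions. -/
def polyHol (W : Opens ℂ) : ℂ[X] →ₐ[ℂ] Hol W := aeval (mon W 1)

@[simp]
theorem polyHol_X (W : Opens ℂ) : polyHol W X = mon W 1 := aeval_X _

@[simp]
theorem polyHol_X_pow (W : Opens ℂ) (k : ℕ) : polyHol W (X ^ k) = mon W k := by
  rw [map_pow, polyHol_X, mon_eq_pow W k]

theorem ddz_polyHol (p : ℂ[X]) : ddz W (polyHol W p) = polyHol W (derivative p) := by
  rw [polyHol, Derivation.map_aeval, ddz_mon_one, smul_eq_mul, mul_one]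

theorem polyHol_apply (p : ℂ[X]) (z : W) : (polyHol W p).1 z = p.eval (z : ℂ) := by
  induction p using Polynomial.induction_on' with
  | add p q hp hq =>
    rw [map_add, eval_add, ← hp, ← hq]; rfl
  | monomial n a =>
    rw [← C_mul_X_pow_eq_monomial, ← smul_eq_C_mul, map_smul, polyHol_X_pow, eval_smul,
      eval_pow, eval_X]; rfl

theorem polyHol_injective (hW : (W : Set ℂ).Nonempty) : Function.Injective (polyHol W) := by
  rw [injective_iff_map_eq_zero]
  intro p hp
  refine p.eq_zero_of_infinite_isRoot ?_
  have hinf : (W : Set ℂ).Infinite :=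
    infinite_of_mem_nhds hW.some (W.isOpen.mem_nhds hW.some_mem)
  refine hinf.mono fun z hz => ?_
  change p.eval z = 0
  rw [← polyHol_apply p ⟨z, hz⟩, hp]; rfl

/-! ### Translation-invariant spaces of pairs of polynomials -/

/-- A finite-dimensional space of polynomials invariant under `d/dX` consists of all polynomials
of degree less than some `n`. -/
theorem exists_eq_degreeLT (Q : Submodule ℂ ℂ[X]) [FiniteDimensional ℂ Q]
    (hQ : ∀ p ∈ Q, derivative p ∈ Q) : ∃ n, Q = degreeLT ℂ n := by
  classical
  have key : ∀ (d : ℕ) (p : ℂ[X]), p ∈ Q → p.degree = d → degreeLT ℂ (d + 1) ≤ Q := by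
    have hX : ∀ (d : ℕ) (p : ℂ[X]), p ∈ Q → p.degree = d → degreeLT ℂ d ≤ Q →
        degreeLT ℂ (d + 1) ≤ Q := by
      intro d p hp hd hle q hq
      have hlead : p.coeff d ≠ 0 := by
        have := coeff_natDegree (p := p)
        rw [natDegree_eq_of_degree_eq_some hd] at this
        rw [this]
        exact leadingCoeff_ne_zero.mpr (fun h => by simp [h] at hd)
      -- Subtracting a multiple of `p` cancels the coefficient of degree `d`, and the remainder is
      -- already known to lie in `Q`.
      have : q - (q.coeff d / p.coeff d) • p ∈ degreeLT ℂ d := by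
        rw [mem_degreeLT, degree_lt_iff_coeff_zero]
        intro m hm
        rw [coeff_sub, coeff_smul, smul_eq_mul]
        rcases hm.eq_or_lt with rfl | hm
        · rw [div_mul_cancel₀ _ hlead, sub_self]
        · have h1 : q.coeff m = 0 :=
            (degree_lt_iff_coeff_zero _ _).1 (mem_degreeLT.1 hq) m hm
          have h2 : p.coeff m = 0 := coeff_eq_zero_of_degree_lt (by
            rw [hd]; exact_mod_cast hm)
          rw [h1, h2]; simp
      simpa using Q.add_mem (hle this) (Q.smul_mem (q.coeff d / p.coeff d) hp)
    intro d
    induction d with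
    | zero =>
      intro p hp hd
      refine hX 0 p hp hd fun q hq => ?_
      have : q = 0 := by simpa [mem_degreeLT] using hq
      rw [this]; exact Q.zero_mem
    | succ d ih =>
      intro p hp hd
      refine hX (d + 1) p hp hd (ih _ (hQ p hp) ?_)
      rw [degree_derivative (by rw [natDegree_eq_of_degree_eq_some hd]; simp),
        natDegree_eq_of_degree_eq_some hd]; simp
  have hex : ∃ n, Q ≤ degreeLT ℂ n := by
    obtain ⟨s, hs⟩ := (Submodule.fg_iff_finiteDimensional Q).2 inferInstance
    obtain ⟨n, hn⟩ := span_of_finite_le_degreeLT (R := ℂ) s.finite_toSet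
    exact ⟨n, hs ▸ hn⟩
  refine ⟨Nat.find hex, le_antisymm (Nat.find_spec hex) ?_⟩
  rcases hn : Nat.find hex with _ | m
  · intro q hq
    have : q = 0 := by simpa [mem_degreeLT] using hq
    rw [this]; exact Q.zero_mem
  · have hlt : ¬ Q ≤ degreeLT ℂ m := Nat.find_min hex (by omega)
    obtain ⟨p, hp, hpm⟩ := SetLike.not_le_iff_exists.1 hlt
    refine key m p hp (le_antisymm ?_ ?_)
    · have := mem_degreeLT.1 (Nat.find_spec hex hp)
      rw [hn] at this
      exact Order.le_of_lt_succ (by exact_mod_cast this)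
    · rw [mem_degreeLT, not_lt] at hpm
      exact hpm

theorem X_pow_mem_degreeLT {k n : ℕ} : (X ^ k : ℂ[X]) ∈ degreeLT ℂ n ↔ k < n := by
  rw [mem_degreeLT, degree_X_pow]; exact_mod_cast Iff.rfl

theorem degreeLT_le_of_X_pow_mem {n : ℕ} {Q : Submodule ℂ ℂ[X]} (h : ∀ k < n, X ^ k ∈ Q) :
    degreeLT ℂ n ≤ Q := by
  classical
  rw [degreeLT_eq_span_X_pow, Submodule.span_le]
  intro q hq
  simp only [Finset.coe_image, Set.mem_image, Finset.coe_range, Set.mem_Iio] at hq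
  obtain ⟨k, hk, rfl⟩ := hq
  exact h k hk

/-- The second component of the `k`-th mixed generator. -/
def mixedPoly (a b : ℕ) (c : ℕ → ℂ) (k : ℕ) : ℂ[X] :=
  ∑ j ∈ Finset.range (k + 1), mixedCoeff a b c k j • X ^ (b + j)

/-- This recursion is the reason for the factorials: it makes the derivative of each mixed generator
proportional to the preceding one, up to a pure term. -/
theorem mixedCoeff_succ_succ (a b : ℕ) (c : ℕ → ℂ) {k j : ℕ} (hj : j ≤ k) :
    mixedCoeff a b c (k + 1) (j + 1) * (b + j + 1 : ℂ) =
      (a + k + 1 : ℂ) * mixedCoeff a b c k j := by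
  unfold mixedCoeff
  rw [show a + (k + 1) - (j + 1) = a + k - j by omega, show k + 1 - (j + 1) = k - j by omega,
    ← add_assoc, ← add_assoc, Nat.factorial_succ (a + k), Nat.factorial_succ (b + j)]
  have h1 : (((b + j).factorial : ℕ) : ℂ) ≠ 0 := by exact_mod_cast Nat.factorial_ne_zero _
  have h2 : (((a + k - j).factorial : ℕ) : ℂ) ≠ 0 := by exact_mod_cast Nat.factorial_ne_zero _
  have h3 : (b + j + 1 : ℂ) ≠ 0 := by exact_mod_cast Nat.succ_ne_zero (b + j)
  push_cast
  field_simp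

/-- The term `j = 0` drops to `X ^ (b - 1)`, which belongs to the pure second-component part. For `b
= 0` the factor `b` makes the truncated exponent harmless. -/
theorem derivative_mixedPoly (a b : ℕ) (c : ℕ → ℂ) (k : ℕ) :
    derivative (mixedPoly a b c (k + 1)) = (a + k + 1 : ℂ) • mixedPoly a b c k +
      (mixedCoeff a b c (k + 1) 0 * b) • X ^ (b - 1) := by
  unfold mixedPoly
  rw [Finset.sum_range_succ', map_add, map_sum, Finset.smul_sum]
  congr 1
  · refine Finset.sum_congr rfl fun j hj => ?_
    rw [derivative_smul, derivative_X_pow, ← smul_eq_C_mul, smul_smul, smul_smul,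
      ← mixedCoeff_succ_succ a b c (Nat.lt_succ_iff.1 (Finset.mem_range.1 hj))]
    simp [add_assoc]
  · rw [derivative_smul, derivative_X_pow, ← smul_eq_C_mul, smul_smul]; simp

/-- The generators, as pairs of polynomials, of an indecomposable block of a translation
bimodule. -/
def blockGens (a b r : ℕ) (c : ℕ → ℂ) : Set (ℂ[X] × ℂ[X]) :=
  {x | ∃ k < a, x = (X ^ k, 0)} ∪ {x | ∃ k < b, x = (0, X ^ k)} ∪
    {x | ∃ k < r, x = (X ^ (a + k), mixedPoly a b c k)}

/-- The coefficient of `X ^ (b + j)` in the mixed polynomial is a nonzero multiple of `c (r - j)`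
alone, so the constants can be solved for one by one. -/
theorem exists_mixedPoly_eq (a b r : ℕ) {h : ℂ[X]} (hh : h.degree < (b + r + 1 : ℕ)) :
    ∃ c : ℕ → ℂ, h - mixedPoly a b c r ∈ degreeLT ℂ b := by
  refine ⟨fun i => h.coeff (b + (r - i)) /
    (((a + r).factorial * b.factorial : ℂ) /
      ((b + (r - i)).factorial * (a + i).factorial)), ?_⟩
  rw [mem_degreeLT, degree_lt_iff_coeff_zero]
  intro m hm
  obtain ⟨j, rfl⟩ := Nat.exists_eq_add_of_le hm
  rw [coeff_sub, mixedPoly, finsetSum_coeff, sub_eq_zero]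
  simp only [coeff_smul, coeff_X_pow, add_right_inj, smul_eq_mul, mul_ite, mul_one, mul_zero,
    Finset.sum_ite_eq, Finset.mem_range]
  split_ifs with hj
  · unfold mixedCoeff
    dsimp only
    rw [show r - (r - j) = j by omega, show a + (r - j) = a + r - j by omega,
      mul_div_cancel₀]
    have h0 : ∀ n : ℕ, ((n.factorial : ℕ) : ℂ) ≠ 0 := fun n => by
      exact_mod_cast Nat.factorial_ne_zero _
    exact div_ne_zero (mul_ne_zero (h0 _) (h0 _)) (mul_ne_zero (h0 _) (h0 _))
  · exact coeff_eq_zero_of_degree_lt (lt_of_lt_of_le hh (by exact_mod_cast (by omega)))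

theorem mixedPoly_zero (a b : ℕ) (c : ℕ → ℂ) : mixedPoly a b c 0 = c 0 • X ^ b := by
  have h0 : ∀ n : ℕ, ((n.factorial : ℕ) : ℂ) ≠ 0 := fun n => by
    exact_mod_cast Nat.factorial_ne_zero _
  simp only [mixedPoly, zero_add, Finset.sum_range_one, mixedCoeff, add_zero, Nat.sub_zero]
  rw [mul_comm, mul_comm (b.factorial : ℂ), div_self (mul_ne_zero (h0 _) (h0 _)), mul_one]

theorem derivative_mem_degreeLT {n : ℕ} {p : ℂ[X]} :
    derivative p ∈ degreeLT ℂ n ↔ p ∈ degreeLT ℂ (n + 1) := by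
  simp only [mem_degreeLT, degree_lt_iff_coeff_zero, coeff_derivative]
  constructor
  · rintro h (_ | m) hm
    · omega
    · have := h m (by omega)
      exact (mul_eq_zero.1 this).resolve_right (by exact_mod_cast Nat.succ_ne_zero m)
  · intro h m hm
    rw [h (m + 1) (by omega), zero_mul]

/-- Structure of a finite-dimensional space of pairs of polynomials invariant under `d/dX`. -/
theorem exists_eq_span_blockGens (P : Submodule ℂ (ℂ[X] × ℂ[X])) [FiniteDimensional ℂ P]
    (hP : ∀ x ∈ P, (derivative x.1, derivative x.2) ∈ P) :
    ∃ (a b r : ℕ) (c : ℕ → ℂ), (0 < r → c 0 ≠ 0) ∧ P = Submodule.span ℂ (blockGens a b r c) ∧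
      (∀ p, (0, p) ∈ P ↔ p ∈ degreeLT ℂ b) := by
  have hfst : FiniteDimensional ℂ (P.comap (LinearMap.inl ℂ ℂ[X] ℂ[X])) :=
    Submodule.finiteDimensional_of_le (S₂ := P.map (LinearMap.fst ℂ ℂ[X] ℂ[X]))
      fun p hp => ⟨_, hp, rfl⟩
  have hsnd : FiniteDimensional ℂ (P.comap (LinearMap.inr ℂ ℂ[X] ℂ[X])) :=
    Submodule.finiteDimensional_of_le (S₂ := P.map (LinearMap.snd ℂ ℂ[X] ℂ[X]))
      fun p hp => ⟨_, hp, rfl⟩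
  obtain ⟨a, ha⟩ := exists_eq_degreeLT (P.comap (LinearMap.inl ℂ ℂ[X] ℂ[X])) fun p hp => by
    simpa using hP _ hp
  obtain ⟨b, hb⟩ := exists_eq_degreeLT (P.comap (LinearMap.inr ℂ ℂ[X] ℂ[X])) fun p hp => by
    simpa using hP _ hp
  obtain ⟨s, hs⟩ := exists_eq_degreeLT (P.map (LinearMap.fst ℂ ℂ[X] ℂ[X])) (by
    rintro _ ⟨x, hx, rfl⟩
    exact ⟨_, hP x hx, rfl⟩)
  replace ha : ∀ p, (p, 0) ∈ P ↔ p ∈ degreeLT ℂ a := fun p => by rw [← ha]; rfl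
  replace hb : ∀ p, (0, p) ∈ P ↔ p ∈ degreeLT ℂ b := fun p => by rw [← hb]; rfl
  have has : a ≤ s := by
    by_contra! h
    have h1 : (X ^ s : ℂ[X]) ∈ P.map (LinearMap.fst ℂ ℂ[X] ℂ[X]) :=
      ⟨(X ^ s, 0), (ha _).2 (X_pow_mem_degreeLT.2 h), rfl⟩
    rw [hs, X_pow_mem_degreeLT] at h1
    exact h1.ne rfl
  obtain ⟨r, rfl⟩ := Nat.exists_eq_add_of_le has
  -- Differentiating a pair lowers both degree bounds by one. At `i = 0` the first component can be
  -- split off inside `P`.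
  have hbound : ∀ (i : ℕ) (q h : ℂ[X]), (q, h) ∈ P → q ∈ degreeLT ℂ (a + i) →
      h ∈ degreeLT ℂ (b + i) := by
    intro i
    induction i with
    | zero =>
      intro q h hqh hq
      rw [add_zero, ← hb]
      simpa using P.sub_mem hqh ((ha q).2 hq)
    | succ i ih =>
      intro q h hqh hq
      have hq' : derivative q ∈ degreeLT ℂ (a + i) := derivative_mem_degreeLT.2 hq
      exact derivative_mem_degreeLT.1 (ih (derivative q) (derivative h) (hP (q, h) hqh) hq')
  -- The constants are read from one element whose first component is the highest power;
  -- differentiating it repeatedly, modulo the pure part, produces all lower mixed generators with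
  -- the same constants.
  obtain ⟨c, hc⟩ : ∃ c : ℕ → ℂ, ∀ k < r, (X ^ (a + k), mixedPoly a b c k) ∈ P := by
    rcases r with _ | r
    · exact ⟨0, by simp⟩
    have htop : (X ^ (a + r) : ℂ[X]) ∈ P.map (LinearMap.fst ℂ ℂ[X] ℂ[X]) := by
      rw [hs]; exact X_pow_mem_degreeLT.2 (by omega)
    obtain ⟨⟨q, h⟩, hx, hq⟩ := htop
    obtain rfl : q = X ^ (a + r) := hq
    obtain ⟨c, hc⟩ := exists_mixedPoly_eq a b r (h := h) (mem_degreeLT.1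
      (hbound (r + 1) _ h hx (X_pow_mem_degreeLT.2 (by omega))))
    refine ⟨c, fun k hk => ?_⟩
    refine Nat.decreasingInduction' (m := k) (n := r)
      (P := fun k => (X ^ (a + k), mixedPoly a b c k) ∈ P) ?_ (by omega) ?_
    · intro k _ _ ih
      have h1 := hP _ ih
      rw [derivative_mixedPoly] at h1
      have h2 : (0, (mixedCoeff a b c (k + 1) 0 * b) • X ^ (b - 1)) ∈ P := by
        rw [hb]
        rcases b with _ | b
        · simp
        · exact Submodule.smul_mem _ _ (X_pow_mem_degreeLT.2 (by omega))
      have h3 := P.smul_mem (a + k + 1 : ℂ)⁻¹ (P.sub_mem h1 h2)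
      have h4 : (a + k + 1 : ℂ) ≠ 0 := by exact_mod_cast Nat.succ_ne_zero (a + k)
      convert h3 using 1
      refine Prod.ext ?_ ?_
      · simp only [Prod.smul_fst, Prod.fst_sub, sub_zero, derivative_X_pow]
        rw [← smul_eq_C_mul, smul_smul, show a + (k + 1) - 1 = a + k by omega]
        push_cast
        rw [← add_assoc, inv_mul_cancel₀ h4, one_smul]
      · simp only [Prod.smul_snd, Prod.snd_sub, add_sub_cancel_right]
        rw [smul_smul, inv_mul_cancel₀ h4, one_smul]
    · simpa using P.sub_mem hx ((hb _).2 hc)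
  refine ⟨a, b, r, c, fun hr hc0 => ?_, le_antisymm ?_ ?_, hb⟩
  -- If `c 0` vanished, `(X ^ a, 0)` would lie in `P`, against the choice of `a`.
  · have h1 := hc 0 hr
    rw [mixedPoly_zero, hc0, zero_smul, ha, X_pow_mem_degreeLT] at h1
    omega
  · intro x hx
    have hle : degreeLT ℂ (a + r) ≤
        (Submodule.span ℂ (blockGens a b r c)).map (LinearMap.fst ℂ ℂ[X] ℂ[X]) := by
      refine degreeLT_le_of_X_pow_mem fun k hk => ?_
      by_cases hka : k < a
      · exact ⟨_, Submodule.subset_span (Or.inl (Or.inl ⟨k, hka, rfl⟩)), rfl⟩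
      · obtain ⟨j, rfl⟩ := Nat.exists_eq_add_of_le (not_lt.1 hka)
        exact ⟨_, Submodule.subset_span (Or.inr ⟨j, by omega, rfl⟩), rfl⟩
    have hle' : degreeLT ℂ b ≤
        (Submodule.span ℂ (blockGens a b r c)).comap (LinearMap.inr ℂ ℂ[X] ℂ[X]) :=
      degreeLT_le_of_X_pow_mem fun k hk =>
        Submodule.subset_span (Or.inl (Or.inr ⟨k, hk, rfl⟩))
    have hspan : Submodule.span ℂ (blockGens a b r c) ≤ P := by
      rw [Submodule.span_le]
      rintro _ ((⟨k, hk, rfl⟩ | ⟨k, hk, rfl⟩) | ⟨k, hk, rfl⟩)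
      · exact (ha _).2 (X_pow_mem_degreeLT.2 hk)
      · exact (hb _).2 (X_pow_mem_degreeLT.2 hk)
      · exact hc k hk
    have hx1 : x.1 ∈ degreeLT ℂ (a + r) := hs ▸ ⟨x, hx, rfl⟩
    obtain ⟨y, hy, hyx⟩ := hle hx1
    have hxy : x - y = (0, x.2 - y.2) := Prod.ext (by simpa [sub_eq_zero] using hyx.symm) rfl
    have := P.sub_mem hx (hspan hy)
    rw [hxy, hb] at this
    have h3 := hle' this
    rw [Submodule.mem_comap, LinearMap.inr_apply, ← hxy] at h3
    simpa using Submodule.add_mem _ h3 hy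
  · rw [Submodule.span_le]
    rintro _ ((⟨k, hk, rfl⟩ | ⟨k, hk, rfl⟩) | ⟨k, hk, rfl⟩)
    · exact (ha _).2 (X_pow_mem_degreeLT.2 hk)
    · exact (hb _).2 (X_pow_mem_degreeLT.2 hk)
    · exact hc k hk

/-- The generators, as pairs of polynomials, of a graded translation bimodule. -/
def gradedGens (a b r : ℕ) (c : ℂ) : Set (ℂ[X] × ℂ[X]) :=
  {x | ∃ k < a, x = (X ^ k, 0)} ∪ {x | ∃ k < b, x = (0, X ^ k)} ∪
    {x | ∃ k < r, x = (X ^ (a + k),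
      (((a + k).factorial * b.factorial : ℂ) / ((b + k).factorial * a.factorial) * c) •
        X ^ (b + k))}

/-- Structure of a finite-dimensional space of pairs of polynomials invariant under `d/dX` and
`X d/dX`. -/
theorem exists_eq_span_gradedGens (P : Submodule ℂ (ℂ[X] × ℂ[X])) [FiniteDimensional ℂ P]
    (hP : ∀ x ∈ P, (derivative x.1, derivative x.2) ∈ P)
    (hE : ∀ x ∈ P, (X * derivative x.1, X * derivative x.2) ∈ P) :
    ∃ (a b r : ℕ) (c : ℂ), c ≠ 0 ∧ (1 ≤ r → a = b) ∧
      P = Submodule.span ℂ (gradedGens a b r c) := by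
  obtain ⟨a, b, r, c, hc, hspan, hb⟩ := exists_eq_span_blockGens P hP
  have hXd : ∀ k : ℕ, X * derivative (X ^ k : ℂ[X]) = (k : ℂ) • X ^ k := by
    rintro (_ | k)
    · simp
    · rw [derivative_X_pow, ← smul_eq_C_mul, mul_smul_comm, Nat.add_sub_cancel, pow_succ']
  -- Applying `X d/dX - (a + k)` kills the first component of the mixed generator. What is left lies
  -- in the pure part, of degree below `b`, yet has only powers from `X ^ b` on, so every
  -- coefficient is zero.
  have hmix : ∀ k < r, ∀ j ≤ k,
      mixedCoeff a b c k j * ((b + j : ℕ) - (a + k : ℕ) : ℂ) = 0 := by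
    intro k hk j hj
    have hg : (X ^ (a + k), mixedPoly a b c k) ∈ P := by
      rw [hspan]; exact Submodule.subset_span (Or.inr ⟨k, hk, rfl⟩)
    have h1 := P.sub_mem (hE _ hg) (P.smul_mem ((a + k : ℕ) : ℂ) hg)
    have h2 : X * derivative (mixedPoly a b c k) - ((a + k : ℕ) : ℂ) • mixedPoly a b c k =
        ∑ j ∈ Finset.range (k + 1),
          (mixedCoeff a b c k j * ((b + j : ℕ) - (a + k : ℕ) : ℂ)) • X ^ (b + j) := by
      rw [mixedPoly, map_sum, Finset.mul_sum, Finset.smul_sum, ← Finset.sum_sub_distrib]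
      refine Finset.sum_congr rfl fun j _ => ?_
      rw [derivative_smul, mul_smul_comm, hXd, smul_smul, smul_smul, ← sub_smul]
      congr 1; ring
    have h3 : (0, ∑ j ∈ Finset.range (k + 1),
        (mixedCoeff a b c k j * ((b + j : ℕ) - (a + k : ℕ) : ℂ)) • X ^ (b + j)) ∈ P := by
      convert h1 using 1
      refine Prod.ext ?_ h2.symm
      simp [hXd]
    rw [hb, mem_degreeLT, degree_lt_iff_coeff_zero] at h3
    have h4 := h3 (b + j) (by omega)
    rw [finsetSum_coeff] at h4
    simp only [coeff_smul, coeff_X_pow, add_right_inj, smul_eq_mul, mul_ite, mul_one, mul_zero,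
      Finset.sum_ite_eq, Finset.mem_range] at h4
    rwa [if_pos (by omega)] at h4
  have h0 : ∀ n : ℕ, ((n.factorial : ℕ) : ℂ) ≠ 0 := fun n => by
    exact_mod_cast Nat.factorial_ne_zero _
  have hab : 1 ≤ r → a = b := by
    intro hr
    have h1 := hmix 0 hr 0 le_rfl
    have h2 : mixedCoeff a b c 0 0 ≠ 0 := by
      unfold mixedCoeff
      exact mul_ne_zero (div_ne_zero (mul_ne_zero (h0 _) (h0 _)) (mul_ne_zero (h0 _) (h0 _)))
        (hc hr)
    have h3 := (mul_eq_zero.1 h1).resolve_left h2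
    rw [sub_eq_zero] at h3
    have h4 : b + 0 = a + 0 := by exact_mod_cast h3
    omega
  have hpoly : ∀ k < r, mixedPoly a b c k =
      (((a + k).factorial * b.factorial : ℂ) / ((b + k).factorial * a.factorial) * c 0) •
        X ^ (b + k) := by
    intro k hk
    rw [mixedPoly, Finset.sum_eq_single_of_mem k (by simp)]
    · simp [mixedCoeff]
    · intro j hj hjk
      have hj' : j < k := by have := Finset.mem_range.1 hj; omega
      have h1 := hmix k hk j hj'.le
      have h2 : ((b + j : ℕ) - (a + k : ℕ) : ℂ) ≠ 0 := by
        rw [sub_ne_zero]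
        have := hab (by omega)
        exact_mod_cast (by omega)
      rw [(mul_eq_zero.1 h1).resolve_right h2, zero_smul]
  have hgens : ∀ c' : ℂ, (0 < r → c' = c 0) → blockGens a b r c = gradedGens a b r c' := by
    intro c' hc'
    unfold blockGens gradedGens
    congr 1
    ext x
    refine exists_congr fun k => and_congr_right fun hk => ?_
    rw [hpoly k hk, hc' (by omega)]
  rcases Nat.eq_zero_or_pos r with rfl | hr
  · exact ⟨a, b, 0, 1, one_ne_zero, by simp, by rw [hspan, hgens 1 (by simp)]⟩
  · exact ⟨a, b, r, c 0, hc hr, hab, by rw [hspan, hgens _ fun _ => rfl]⟩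

/-- A finite-dimensional space of pairs of polynomials invariant under `d/dX` and `X² d/dX`
consists of constants. -/
theorem exists_eq_span_of_invariant_sq (P : Submodule ℂ (ℂ[X] × ℂ[X])) [FiniteDimensional ℂ P]
    (hP : ∀ x ∈ P, (derivative x.1, derivative x.2) ∈ P)
    (hS : ∀ x ∈ P, (X ^ 2 * derivative x.1, X ^ 2 * derivative x.2) ∈ P) :
    ∃ (γ : ℂ) (S : Set (ℂ[X] × ℂ[X])), S ⊆ {(1, C γ), (0, 1)} ∧ P = Submodule.span ℂ S := by
  -- `X² d/dX` sends `X ^ k` to a nonzero multiple of `X ^ (k + 1)` for `k ≥ 1`, so no positive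
  -- power can be the highest one.
  have hle : ∀ (Q : Submodule ℂ ℂ[X]) [FiniteDimensional ℂ Q], (∀ p ∈ Q, derivative p ∈ Q) →
      (∀ p ∈ Q, X ^ 2 * derivative p ∈ Q) → Q ≤ degreeLT ℂ 1 := by
    intro Q _ h1 h2
    obtain ⟨n, rfl⟩ := exists_eq_degreeLT Q h1
    refine degreeLT_mono ?_
    by_contra! hn
    obtain ⟨m, rfl⟩ : ∃ m, n = m + 2 := ⟨n - 2, by omega⟩
    have h3 := h2 (X ^ (m + 1)) (X_pow_mem_degreeLT.2 (by omega))
    rw [derivative_X_pow, ← smul_eq_C_mul, mul_smul_comm, Nat.add_sub_cancel, ← pow_add,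
      Submodule.smul_mem_iff _ (by exact_mod_cast Nat.succ_ne_zero m), X_pow_mem_degreeLT] at h3
    omega
  have hfst := hle (P.map (LinearMap.fst ℂ ℂ[X] ℂ[X]))
    (by rintro _ ⟨x, hx, rfl⟩; exact ⟨_, hP x hx, rfl⟩)
    (by rintro _ ⟨x, hx, rfl⟩; exact ⟨_, hS x hx, rfl⟩)
  have hsnd := hle (P.map (LinearMap.snd ℂ ℂ[X] ℂ[X]))
    (by rintro _ ⟨x, hx, rfl⟩; exact ⟨_, hP x hx, rfl⟩)
    (by rintro _ ⟨x, hx, rfl⟩; exact ⟨_, hS x hx, rfl⟩)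
  obtain ⟨a, b, r, c, hc, hspan, -⟩ := exists_eq_span_blockGens P hP
  have ha : a + r ≤ 1 := by
    by_contra! h
    by_cases hr : r = 0
    · have := hfst ⟨(X ^ 1, 0), by
        rw [hspan]; exact Submodule.subset_span (Or.inl (Or.inl ⟨1, by omega, rfl⟩)), rfl⟩
      exact absurd (X_pow_mem_degreeLT.1 this) (by omega)
    · have := hfst ⟨(X ^ (a + (r - 1)), _), by
        rw [hspan]; exact Submodule.subset_span (Or.inr ⟨r - 1, by omega, rfl⟩), rfl⟩
      exact absurd (X_pow_mem_degreeLT.1 this) (by omega)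
  have hb : b + r ≤ 1 := by
    by_contra! h
    by_cases hr : r = 0
    · have := hsnd ⟨(0, X ^ 1), by
        rw [hspan]; exact Submodule.subset_span (Or.inl (Or.inr ⟨1, by omega, rfl⟩)), rfl⟩
      exact absurd (X_pow_mem_degreeLT.1 this) (by omega)
    · have := hsnd ⟨(X ^ (a + 0), mixedPoly a b c 0), by
        rw [hspan]; exact Submodule.subset_span (Or.inr ⟨0, by omega, rfl⟩), rfl⟩
      rw [mixedPoly_zero, LinearMap.snd_apply, Submodule.smul_mem_iff _ (hc (by omega)),
        X_pow_mem_degreeLT] at this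
      omega
  -- If `r = 0` the only possible generator with first component `1` is `(1, 0)`, hence `γ = 0`; if
  -- `r = 1` then `a = b = 0` and it is the mixed generator `(1, C (c 0))`.
  refine ⟨if r = 0 then 0 else c 0, blockGens a b r c, ?_, hspan⟩
  rintro _ ((⟨k, hk, rfl⟩ | ⟨k, hk, rfl⟩) | ⟨k, hk, rfl⟩)
  · obtain rfl : k = 0 := by omega
    rw [if_pos (by omega)]
    left; simp
  · obtain rfl : k = 0 := by omega
    right; simp
  · obtain rfl : k = 0 := by omega
    obtain rfl : a = 0 := by omega
    obtain rfl : b = 0 := by omega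
    rw [if_neg (by omega), mixedPoly_zero]
    left; simp [smul_eq_C_mul]

/-! ### Translation-invariant spaces of pairs of analytic functions -/

theorem dz_apply (x : SFun W) : dz W x = (ddz W x.1, ddz W x.2) := rfl

theorem expHol_mul_neg (μ : ℂ) : expHol W μ * expHol W (-μ) = 1 :=
  Hol.ext' fun z => by
    change Complex.exp (ext0 (μ • mon W 1).1 z) * Complex.exp (ext0 (-μ • mon W 1).1 z) = 1
    rw [ext0_apply, ext0_apply, ← Complex.exp_add]
    simp

/-- The product of `f` with `e^{-μz}` has zero derivative. -/
theorem exists_eq_smul_expHol (hW : IsPreconnected (W : Set ℂ)) {f : Hol W} {μ : ℂ}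
    (hf : ddz W f = μ • f) : ∃ c : ℂ, f = c • expHol W μ := by
  obtain ⟨c, hc⟩ := exists_eq_smul_one_of_ddz_eq_zero hW (f := f * expHol W (-μ)) (by
    rw [Derivation.leibniz, hf, ddz_expHol]
    simp only [smul_eq_mul, Algebra.smul_def, map_neg]
    ring)
  refine ⟨c, ?_⟩
  calc f = expHol W μ * (f * expHol W (-μ)) := by
        rw [mul_left_comm, expHol_mul_neg, mul_one]
    _ = c • expHol W μ := by rw [hc, mul_smul_comm, mul_one]

theorem exists_derivative_eq (p : ℂ[X]) : ∃ q : ℂ[X], derivative q = p := by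
  induction p using Polynomial.induction_on' with
  | add p q hp hq =>
    obtain ⟨p, rfl⟩ := hp
    obtain ⟨q, rfl⟩ := hq
    exact ⟨p + q, map_add _ _ _⟩
  | monomial n a =>
    refine ⟨monomial (n + 1) (a / (n + 1 : ℕ)), ?_⟩
    rw [derivative_monomial, Nat.add_sub_cancel,
      div_mul_cancel₀ _ (by exact_mod_cast Nat.succ_ne_zero n)]

/-- On `e^{μz} p` the operator `d/dz - μ` acts as `p ↦ p'`. Each induction step integrates a
polynomial and absorbs the remaining multiple of `e^{μz}` into its constant term. -/
theorem exists_eq_expHol_mul_polyHol (hW : IsPreconnected (W : Set ℂ)) (μ : ℂ) (n : ℕ) :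
    ∀ f : Hol W, (((ddz W : Hol W →ₗ[ℂ] Hol W) - μ • (1 : Module.End ℂ (Hol W))) ^ n) f = 0 →
      ∃ p, f = expHol W μ * polyHol W p := by
  induction n with
  | zero => intro f hf; exact ⟨0, by simpa using hf⟩
  | succ n ih =>
    intro f hf
    rw [pow_succ, Module.End.mul_apply] at hf
    obtain ⟨p, hp⟩ := ih _ hf
    obtain ⟨q, rfl⟩ := exists_derivative_eq p
    obtain ⟨c, hc⟩ := exists_eq_smul_expHol hW (f := f - expHol W μ * polyHol W q) (μ := μ) (by
      have hp' : ddz W f - μ • f = expHol W μ * polyHol W (derivative q) := hp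
      rw [map_sub, Derivation.leibniz, ddz_expHol, ddz_polyHol, sub_eq_iff_eq_add.1 hp']
      simp only [smul_eq_mul, Algebra.smul_def]
      ring)
    refine ⟨q + C c, ?_⟩
    rw [map_add, mul_add, ← sub_eq_iff_eq_add', hc, ← mul_one (C c), ← smul_eq_C_mul, map_smul,
      map_one, mul_smul_comm, mul_one]

/-- The pair of functions `e^{μz} (p(z), q(z))`. -/
def expPair (W : Opens ℂ) (μ : ℂ) : ℂ[X] × ℂ[X] →ₗ[ℂ] SFun W :=
  mulBy (expHol W μ) ∘ₗ (polyHol W).toLinearMap.prodMap (polyHol W).toLinearMap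

theorem expPair_apply (μ : ℂ) (x : ℂ[X] × ℂ[X]) :
    expPair W μ x = (expHol W μ * polyHol W x.1, expHol W μ * polyHol W x.2) := rfl

theorem expPair_zero_apply (x : ℂ[X] × ℂ[X]) :
    expPair W 0 x = (polyHol W x.1, polyHol W x.2) := by
  rw [expPair_apply, expHol_zero, one_mul, one_mul]

theorem dz_expPair (μ : ℂ) (x : ℂ[X] × ℂ[X]) :
    dz W (expPair W μ x) =
      expPair W μ (derivative x.1, derivative x.2) + μ • expPair W μ x := by
  simp only [dz_apply, expPair_apply, Derivation.leibniz, ddz_expHol, ddz_polyHol, smul_eq_mul,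
    Prod.smul_mk, Prod.mk_add_mk, mul_smul_comm, mul_comm (polyHol W _) (expHol W μ)]

theorem expPair_injective (hW : (W : Set ℂ).Nonempty) (μ : ℂ) :
    Function.Injective (expPair W μ) := by
  have hu : ∀ p q, expHol W μ * polyHol W p = expHol W μ * polyHol W q → p = q := fun p q h =>
    polyHol_injective hW ((isUnit_exp (μ • mon W 1)).mul_left_cancel h)
  intro x y h
  simp only [expPair_apply, Prod.mk.injEq] at h
  exact Prod.ext (hu _ _ h.1) (hu _ _ h.2)

theorem finiteDimensional_comap {E F : Type*} [AddCommGroup E] [Module ℂ E] [AddCommGroup F]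
    [Module ℂ F] {f : E →ₗ[ℂ] F} (hf : Function.Injective f) (A : Submodule ℂ F)
    [FiniteDimensional ℂ A] : FiniteDimensional ℂ (A.comap f) :=
  FiniteDimensional.of_injective (f.submoduleComap A) fun _ _ h =>
    Subtype.ext (hf (congrArg Subtype.val h))

/-- A finite-dimensional translation-invariant space of pairs of functions is spanned by pairs of
quasi-polynomials. -/
theorem le_iSup_map_expPair (hW : IsPreconnected (W : Set ℂ)) (A : Submodule ℂ (SFun W))
    [FiniteDimensional ℂ A] (hA : ∀ x ∈ A, dz W x ∈ A) :
    A ≤ ⨆ μ, (A.comap (expPair W μ)).map (expPair W μ) := by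
  -- Over `ℂ` a finite-dimensional space is the sum of the generalized eigenspaces of `d/dz`, and
  -- these consist of quasi-polynomials.
  have h1 := Module.End.iSup_maxGenEigenspace_eq_top (K := ℂ) (V := A) ((dz W).restrict hA)
  have h2 := congrArg (Submodule.map A.subtype) h1
  rw [Submodule.map_top, Submodule.range_subtype, Submodule.map_iSup] at h2
  refine h2.ge.trans (iSup_mono fun μ => ?_)
  rintro _ ⟨x, hx, rfl⟩
  have hx' : (x : SFun W) ∈ (dz W).maxGenEigenspace μ := by
    have := Module.End.genEigenspace_restrict (dz W) A ⊤ μ hA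
    have h3 : x ∈ Module.End.genEigenspace ((dz W).restrict hA) μ ⊤ := hx
    rw [this] at h3
    exact h3
  obtain ⟨n, hn⟩ := (Module.End.mem_maxGenEigenspace _ _ _).1 hx'
  have hcomp : ∀ (n : ℕ) (y : SFun W), ((dz W - μ • (1 : Module.End ℂ (SFun W))) ^ n) y =
      ((((ddz W : Hol W →ₗ[ℂ] Hol W) - μ • (1 : Module.End ℂ (Hol W))) ^ n) y.1,
       (((ddz W : Hol W →ₗ[ℂ] Hol W) - μ • (1 : Module.End ℂ (Hol W))) ^ n) y.2) := by
    intro n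
    induction n with
    | zero => intro y; rfl
    | succ n ih =>
      intro y
      simp only [pow_succ, Module.End.mul_apply]
      rw [ih]; rfl
  rw [hcomp] at hn
  obtain ⟨p, hp⟩ := exists_eq_expHol_mul_polyHol hW μ n _ (congrArg Prod.fst hn)
  obtain ⟨q, hq⟩ := exists_eq_expHol_mul_polyHol hW μ n _ (congrArg Prod.snd hn)
  have hpq : expPair W μ (p, q) = x := Prod.ext hp.symm hq.symm
  exact ⟨(p, q), by rw [SetLike.mem_coe, Submodule.mem_comap, hpq]; exact x.2, hpq⟩

theorem derivative_mem_comap_expPair {A : Submodule ℂ (SFun W)} (hA : ∀ x ∈ A, dz W x ∈ A)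
    (μ : ℂ) : ∀ x ∈ A.comap (expPair W μ), (derivative x.1, derivative x.2) ∈
      A.comap (expPair W μ) := by
  intro x hx
  have h1 := dz_expPair (W := W) μ x
  rw [Submodule.mem_comap, ← sub_eq_iff_eq_add.2 h1]
  exact A.sub_mem (hA _ hx) (A.smul_mem μ hx)

/-- The multiplicative operator `g(z) θ ∂_θ + h(z)`, as a linear function of `(g, h)`. -/
def aOpHom (W : Opens ℂ) : SFun W →ₗ[ℂ] Module.End ℂ (SFun W) where
  toFun x := aOp x.1 x.2
  map_add' x y := LinearMap.ext fun F => by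
    simp only [aOp, evenOp_apply, LinearMap.add_apply, Prod.fst_add, Prod.snd_add, Prod.mk_add_mk]
    refine Prod.ext ?_ ?_ <;> dsimp only <;> ring
  map_smul' c x := LinearMap.ext fun F => by
    simp only [aOp, evenOp_apply, LinearMap.smul_apply, Prod.smul_fst, Prod.smul_snd,
      Prod.smul_mk, smul_mul_assoc, zero_mul, zero_add, smul_add, RingHom.id_apply]

theorem aOpHom_apply (x : SFun W) : aOpHom W x = aOp x.1 x.2 := rfl

theorem expHol_mul_polyHol_X_pow (μ : ℂ) (k : ℕ) :
    expHol W μ * polyHol W (X ^ k) = expMon W μ k := by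
  rw [polyHol_X_pow, expMon_eq, mul_comm]

/-- A finite-dimensional translation-invariant space of operators `g θ ∂_θ + h` is one of the
spaces `bimodule W M a b r c`. -/
theorem exists_map_aOpHom_eq_bimodule (hW : IsConnected (W : Set ℂ)) (A : Submodule ℂ (SFun W))
    [FiniteDimensional ℂ A] (hA : ∀ x ∈ A, dz W x ∈ A) :
    ∃ (M : Finset ℂ) (a b r : ℂ → ℕ) (c : ℂ → ℕ → ℂ),
      (∀ μ ∈ M, 0 < r μ → c μ 0 ≠ 0) ∧ A.map (aOpHom W) = bimodule W M a b r c := by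
  have hfin : ∀ μ, FiniteDimensional ℂ (A.comap (expPair W μ)) := fun μ =>
    finiteDimensional_comap (expPair_injective hW.nonempty μ) A
  choose a b r c hc hspan _ using fun μ => exists_eq_span_blockGens (A.comap (expPair W μ))
    (derivative_mem_comap_expPair hA μ)
  have hle := le_iSup_map_expPair hW.isPreconnected A hA
  -- A finitely generated subspace is a compact element of the lattice, so finitely many exponents
  -- suffice.
  obtain ⟨M, hM⟩ : ∃ M : Finset ℂ, A ≤ ⨆ μ ∈ M, (A.comap (expPair W μ)).map (expPair W μ) := by
    have hcpt := (Submodule.fg_iff_compact A).1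
      ((Submodule.fg_iff_finiteDimensional A).2 inferInstance)
    simp only [← Finset.sup_eq_iSup]
    exact (CompleteLattice.isCompactElement_iff_exists_le_iSup_of_le_iSup A).1 hcpt ℂ _ hle
  have hAeq : A = ⨆ μ ∈ M, (A.comap (expPair W μ)).map (expPair W μ) :=
    le_antisymm hM (iSup₂_le fun μ _ => Submodule.map_comap_le _ _)
  refine ⟨M, a, b, r, c, fun μ _ => hc μ, ?_⟩
  conv_lhs => rw [hAeq]
  simp only [hspan, Submodule.map_span, Submodule.map_iSup]
  rw [← Submodule.span_iUnion₂, bimodule]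
  have hmix : ∀ μ k, expHol W μ * polyHol W (mixedPoly (a μ) (b μ) (c μ) k) =
      ∑ j ∈ Finset.range (k + 1),
          mixedCoeff (a μ) (b μ) (c μ) k j • expMon W μ (b μ + j) := by
    intro μ k
    simp only [mixedPoly, map_sum, Finset.mul_sum, map_smul, mul_smul_comm,
      expHol_mul_polyHol_X_pow]
  congr 1
  ext T
  simp only [Set.mem_iUnion, exists_prop, blockGens, Set.image_union, Set.mem_union]
  constructor
  · rintro ⟨μ, hμ, (⟨_, ⟨_, ⟨k, hk, rfl⟩, rfl⟩, rfl⟩ | ⟨_, ⟨_, ⟨k, hk, rfl⟩, rfl⟩, rfl⟩) |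
      ⟨_, ⟨_, ⟨k, hk, rfl⟩, rfl⟩, rfl⟩⟩
    · refine Or.inl (Or.inl ⟨μ, hμ, k, hk, ?_⟩)
      simp only [aOpHom_apply, expPair_apply, expHol_mul_polyHol_X_pow, map_zero, mul_zero]
    · refine Or.inl (Or.inr ⟨μ, hμ, k, hk, ?_⟩)
      simp only [aOpHom_apply, expPair_apply, expHol_mul_polyHol_X_pow, map_zero, mul_zero]
    · refine Or.inr ⟨μ, hμ, k, hk, ?_⟩
      simp only [aOpHom_apply, expPair_apply, expHol_mul_polyHol_X_pow, hmix]
  · rintro ((⟨μ, hμ, k, hk, rfl⟩ | ⟨μ, hμ, k, hk, rfl⟩) | ⟨μ, hμ, k, hk, rfl⟩)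
    · refine ⟨μ, hμ, Or.inl (Or.inl ⟨_, ⟨_, ⟨k, hk, rfl⟩, rfl⟩, ?_⟩)⟩
      simp only [aOpHom_apply, expPair_apply, expHol_mul_polyHol_X_pow, map_zero, mul_zero]
    · refine ⟨μ, hμ, Or.inl (Or.inr ⟨_, ⟨_, ⟨k, hk, rfl⟩, rfl⟩, ?_⟩)⟩
      simp only [aOpHom_apply, expPair_apply, expHol_mul_polyHol_X_pow, map_zero, mul_zero]
    · refine ⟨μ, hμ, Or.inr ⟨_, ⟨_, ⟨k, hk, rfl⟩, rfl⟩, ?_⟩⟩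
      simp only [aOpHom_apply, expPair_apply, expHol_mul_polyHol_X_pow, hmix]

/-- A finite-dimensional space of pairs of functions invariant under `d/dz` and `z d/dz` consists
of pairs of polynomials. -/
theorem eq_map_expPair_zero (hW : IsConnected (W : Set ℂ)) (A : Submodule ℂ (SFun W))
    [FiniteDimensional ℂ A] (hA : ∀ x ∈ A, dz W x ∈ A)
    (hE : ∀ x ∈ A, mulBy (mon W 1) (dz W x) ∈ A) :
    A = (A.comap (expPair W 0)).map (expPair W 0) := by
  refine le_antisymm ((le_iSup_map_expPair hW.isPreconnected A hA).trans (iSup_le fun μ => ?_))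
    (Submodule.map_comap_le _ _)
  rcases eq_or_ne μ 0 with rfl | hμ
  · exact le_rfl
  have hfin : FiniteDimensional ℂ (A.comap (expPair W μ)) :=
    finiteDimensional_comap (expPair_injective hW.nonempty μ) A
  have hD := derivative_mem_comap_expPair hA μ
  have hX : ∀ x ∈ A.comap (expPair W μ),
      (X * derivative x.1 + μ • (X * x.1), X * derivative x.2 + μ • (X * x.2)) ∈
        A.comap (expPair W μ) := by
    intro x hx
    have h1 := hE _ hx
    rw [dz_expPair] at h1
    rw [Submodule.mem_comap]
    convert h1 using 1
    simp only [expPair_apply, mulBy, LinearMap.prodMap_apply, LinearMap.mulLeft_apply,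
      map_add, map_mul, polyHol_X, map_smul, mul_add, mul_smul_comm, mul_left_comm (mon W 1),
      Prod.smul_mk, Prod.mk_add_mk]
  have hzero : ∀ (Q : Submodule ℂ ℂ[X]) [FiniteDimensional ℂ Q], (∀ p ∈ Q, derivative p ∈ Q) →
      (∀ p ∈ Q, X * derivative p + μ • (X * p) ∈ Q) → ∀ p ∈ Q, p = 0 := by
    intro Q _ h1 h2
    obtain ⟨n, rfl⟩ := exists_eq_degreeLT Q h1
    rcases n with _ | n
    · intro p hp; simpa [mem_degreeLT] using hp
    · exfalso
      -- For the highest power `X ^ n`, the term `X p'` stays in the space while `μ X p` has degree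
      -- `n + 1`, a contradiction.
      have h3 := h2 (X ^ n) (X_pow_mem_degreeLT.2 (by omega))
      have h4 : X * derivative (X ^ n : ℂ[X]) ∈ degreeLT ℂ (n + 1) := by
        rcases n with _ | n
        · simp
        · rw [derivative_X_pow, ← smul_eq_C_mul, mul_smul_comm, Nat.add_sub_cancel, ← pow_succ']
          exact Submodule.smul_mem _ _ (X_pow_mem_degreeLT.2 (by omega))
      rw [Submodule.add_mem_iff_right _ h4, Submodule.smul_mem_iff _ hμ, ← pow_succ',
        X_pow_mem_degreeLT] at h3
      omega
  have hbot : A.comap (expPair W μ) = ⊥ := by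
    rw [Submodule.eq_bot_iff]
    intro x hx
    refine Prod.ext ?_ ?_
    · refine hzero ((A.comap (expPair W μ)).map (LinearMap.fst ℂ ℂ[X] ℂ[X])) ?_ ?_ _ ⟨x, hx, rfl⟩
      · rintro _ ⟨y, hy, rfl⟩; exact ⟨_, hD y hy, rfl⟩
      · rintro _ ⟨y, hy, rfl⟩; exact ⟨_, hX y hy, rfl⟩
    · refine hzero ((A.comap (expPair W μ)).map (LinearMap.snd ℂ ℂ[X] ℂ[X])) ?_ ?_ _ ⟨x, hx, rfl⟩
      · rintro _ ⟨y, hy, rfl⟩; exact ⟨_, hD y hy, rfl⟩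
      · rintro _ ⟨y, hy, rfl⟩; exact ⟨_, hX y hy, rfl⟩
  rw [hbot, Submodule.map_bot]
  exact bot_le

/-! ### Even operators as triples of coefficients -/

/-- The coefficients `(f, (g, h))` of an even operator `f ∂_z + g θ ∂_θ + h`. -/
abbrev Coeffs (U : Opens ℂ) : Type := Hol U × SFun U

/-- The even operator with given coefficients. -/
def evenHom (U : Opens ℂ) : Coeffs U →ₗ[ℂ] Module.End ℂ (SFun U) where
  toFun t := evenOp t.1 t.2.1 t.2.2
  map_add' s t := LinearMap.ext fun F => by
    simp only [evenOp_apply, LinearMap.add_apply, Prod.fst_add, Prod.snd_add, Prod.mk_add_mk]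
    refine Prod.ext ?_ ?_ <;> dsimp only <;> ring
  map_smul' c t := LinearMap.ext fun F => by
    simp only [evenOp_apply, LinearMap.smul_apply, Prod.smul_fst, Prod.smul_snd,
      Prod.smul_mk, smul_mul_assoc, smul_add, RingHom.id_apply]

theorem evenHom_apply (t : Coeffs U) : evenHom U t = evenOp t.1 t.2.1 t.2.2 := rfl

theorem evenHom_injective (U : Opens ℂ) : Function.Injective (evenHom U) := by
  rw [injective_iff_map_eq_zero]
  intro t ht
  -- Evaluation at `1` isolates `h`; evaluation at `z + θ` then gives `f` and `g`.
  have h1 := LinearMap.congr_fun ht (1, 0)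
  have h2 := LinearMap.congr_fun ht (mon U 1, 1)
  simp only [evenHom_apply, evenOp_apply, LinearMap.zero_apply, Derivation.map_one_eq_zero,
    mul_zero, zero_add, add_zero, mul_one, ddz_mon_one, Prod.mk_eq_zero, map_zero] at h1 h2
  obtain ⟨h1, -⟩ := h1
  rw [h1, zero_mul, add_zero, add_zero] at h2
  exact Prod.ext h2.1 (Prod.ext h2.2 h1)

/-- The coefficients of the commutator. -/
def coeffsLie (s t : Coeffs U) : Coeffs U :=
  (s.1 * ddz U t.1 - t.1 * ddz U s.1, mulBy s.1 (dz U t.2) - mulBy t.1 (dz U s.2))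

theorem lie_evenHom (s t : Coeffs U) : ⁅evenHom U s, evenHom U t⁆ = evenHom U (coeffsLie s t) :=
  evenOp_lie _ _ _ _ _ _

/-- The space of coefficients `L` is closed under the commutator. -/
def LieClosed (L : Submodule ℂ (Coeffs U)) : Prop :=
  ∀ s ∈ L, ∀ t ∈ L, coeffsLie s t ∈ L

/-- The gauge transformation `(f, g, h) ↦ (f, g + f ξ₁, h + f ξ₂)`. -/
def gauge (ξ : SFun U) : Coeffs U →ₗ[ℂ] Coeffs U where
  toFun t := (t.1, t.2 + mulBy t.1 ξ)
  map_add' s t := by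
    refine Prod.ext rfl (Prod.ext ?_ ?_) <;> simp [mulBy, add_mul] <;> abel
  map_smul' c t := by
    refine Prod.ext rfl (Prod.ext ?_ ?_) <;> simp [mulBy]

theorem gauge_apply (ξ : SFun U) (t : Coeffs U) : gauge ξ t = (t.1, t.2 + mulBy t.1 ξ) := rfl

/-- The new terms containing `ξ'` carry the product of the two vector field parts and cancel by
antisymmetry; the others assemble to the bracket of these parts times `ξ`. -/
theorem gauge_coeffsLie (ξ : SFun U) (s t : Coeffs U) :
    gauge ξ (coeffsLie s t) = coeffsLie (gauge ξ s) (gauge ξ t) := by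
  refine Prod.ext rfl (Prod.ext ?_ ?_) <;>
  · simp only [gauge_apply, coeffsLie, mulBy, dz_apply, LinearMap.prodMap_apply,
      LinearMap.mulLeft_apply, Prod.fst_add, Prod.snd_add, Prod.fst_sub, Prod.snd_sub, map_add,
      Derivation.leibniz, smul_eq_mul]
    ring

theorem LieClosed.map_gauge {L : Submodule ℂ (Coeffs U)} (hL : LieClosed L) (ξ : SFun U) :
    LieClosed (L.map (gauge ξ)) := by
  rintro _ ⟨s, hs, rfl⟩ _ ⟨t, ht, rfl⟩
  exact ⟨_, hL s hs t ht, gauge_coeffsLie ξ s t⟩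

/-! ### Change of variables -/

/-- Composition with the change of variable, as a homomorphism of algebras. -/
def Transf.compHom (Φ : Transf V W) : Hol W →ₐ[ℂ] Hol V where
  toFun := Φ.comp
  map_one' := rfl
  map_mul' _ _ := rfl
  map_zero' := rfl
  map_add' _ _ := rfl
  commutes' _ := rfl

theorem Transf.compHom_apply (Φ : Transf V W) (u : Hol W) : Φ.compHom u = Φ.comp u := rfl

theorem Transf.comp_mul (Φ : Transf V W) (u v : Hol W) :
    Φ.comp (u * v) = Φ.comp u * Φ.comp v := rfl

theorem Transf.comp_sub (Φ : Transf V W) (u v : Hol W) :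
    Φ.comp (u - v) = Φ.comp u - Φ.comp v := rfl

theorem res_mul (hVU : V ≤ U) (f g : Hol U) : res hVU (f * g) = res hVU f * res hVU g :=
  map_mul (resHom hVU) f g

theorem res_sub (hVU : V ≤ U) (f g : Hol U) : res hVU (f - g) = res hVU f - res hVU g :=
  map_sub (resHom hVU) f g

/-- For surjectivity, a function on `V` is transported through the set-theoretic inverse of `φ`.
Since `φ'` never vanishes, analyticity of the composite with `φ` implies analyticity of the function
itself. -/
theorem Transf.compHom_bijective (Φ : Transf V W) : Function.Bijective Φ.compHom := by
  constructor
  · intro u v h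
    refine Hol.ext' fun w => ?_
    obtain ⟨z, rfl⟩ := Φ.bijective.2 w
    exact congrFun (congrArg Subtype.val h) z
  · intro u
    obtain ⟨ψ, hψ, hφ⟩ := Function.bijective_iff_has_inverse.1 Φ.bijective
    refine ⟨⟨fun w => u.1 (ψ w), fun w hw => ?_⟩, Hol.ext' fun z => congrArg u.1 (hψ z)⟩
    obtain ⟨z, hz⟩ := Φ.bijective.2 ⟨w, hw⟩
    have hzw : ext0 Φ.φ.1 z = w := by
      rw [ext0_apply]; exact congrArg Subtype.val hz
    rw [← hzw, ← analyticAt_comp_iff_of_deriv_ne_zero (Φ.φ.2 z z.2) (Φ.deriv_ne z)]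
    refine (u.2 z z.2).congr ?_
    filter_upwards [V.isOpen.mem_nhds z.2] with y hy
    have h1 : ext0 Φ.φ.1 y = Φ.φ.1 ⟨y, hy⟩ := ext0_apply Φ.φ.1 ⟨y, hy⟩
    rw [Function.comp_apply, h1, ext0_apply u.1 ⟨y, hy⟩]
    have h2 := ext0_apply (fun w : W => u.1 (ψ w)) ⟨Φ.φ.1 ⟨y, hy⟩, Φ.mapsTo _⟩
    exact (h2.trans (congrArg u.1 (hψ ⟨y, hy⟩))).symm

theorem Transf.ddz_comp (Φ : Transf V W) (u : Hol W) :
    ddz V (Φ.comp u) = ddz V Φ.φ * Φ.comp (ddz W u) :=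
  ddz_eq_of_hasDerivAt (F := ext0 u.1 ∘ ext0 Φ.φ.1)
    (fun z => by
      rw [Function.comp_apply, ext0_apply]
      exact (ext0_apply u.1 ⟨Φ.φ.1 z, Φ.mapsTo z⟩).symm)
    fun z => by
      have h1 := hasDerivAt_ext0 Φ.φ z
      have h2 := hasDerivAt_ext0 u ⟨Φ.φ.1 z, Φ.mapsTo z⟩
      have h3 := HasDerivAt.comp (z : ℂ) (by rw [ext0_apply]; exact h2) h1
      rw [mul_comm] at h3
      exact h3

theorem Transf.comp_mon_one (Φ : Transf V W) : Φ.comp (mon W 1) = Φ.φ :=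
  Hol.ext' fun _ => pow_one _

/-- Composition with the change of variable, as an isomorphism of algebras. -/
def Transf.compEquiv (Φ : Transf V W) : Hol W ≃ₐ[ℂ] Hol V :=
  AlgEquiv.ofBijective Φ.compHom Φ.compHom_bijective

theorem Transf.comp_symm (Φ : Transf V W) (u : Hol V) : Φ.comp (Φ.compEquiv.symm u) = u :=
  Φ.compEquiv.apply_symm_apply u

theorem Transf.symm_comp (Φ : Transf V W) (u : Hol W) : Φ.compEquiv.symm (Φ.comp u) = u :=
  Φ.compEquiv.symm_apply_apply u

/-- The coefficients in the new variable `z̄ = φ(z)`, without any change of `θ` or gauge. -/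
def Transf.transport (Φ : Transf V W) (hVU : V ≤ U) : Coeffs U →ₗ[ℂ] Coeffs W :=
  (Φ.compEquiv.symm.toLinearMap ∘ₗ LinearMap.mulLeft ℂ (ddz V Φ.φ) ∘ₗ
      (resHom hVU).toLinearMap).prodMap
    ((Φ.compEquiv.symm.toLinearMap ∘ₗ (resHom hVU).toLinearMap).prodMap
      (Φ.compEquiv.symm.toLinearMap ∘ₗ (resHom hVU).toLinearMap))

theorem Transf.transport_apply (Φ : Transf V W) (hVU : V ≤ U) (t : Coeffs U) :
    Φ.transport hVU t = (Φ.compEquiv.symm (ddz V Φ.φ * res hVU t.1),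
      Φ.compEquiv.symm (res hVU t.2.1), Φ.compEquiv.symm (res hVU t.2.2)) := rfl

theorem Transf.transport_coeffsLie (Φ : Transf V W) (hVU : V ≤ U) (s t : Coeffs U) :
    Φ.transport hVU (coeffsLie s t) = coeffsLie (Φ.transport hVU s) (Φ.transport hVU t) := by
  have hinj := Φ.compHom_bijective.1
  have hd : ∀ u : Hol V, ddz V Φ.φ * Φ.comp (ddz W (Φ.compEquiv.symm u)) = ddz V u := fun u => by
    rw [← Φ.ddz_comp, Φ.comp_symm]
  refine Prod.ext (hinj ?_) (Prod.ext (hinj ?_) (hinj ?_))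
  · simp only [Transf.compHom_apply, transport_apply, coeffsLie, Transf.comp_sub, Transf.comp_mul,
      Φ.comp_symm, res_sub, res_mul]
    have h1 := hd (ddz V Φ.φ * res hVU s.1)
    have h2 := hd (ddz V Φ.φ * res hVU t.1)
    rw [Derivation.leibniz, smul_eq_mul, smul_eq_mul, ddz_res] at h1 h2
    linear_combination (- res hVU s.1) * h2 + res hVU t.1 * h1
  · have h1 := hd (res hVU s.2.1)
    have h2 := hd (res hVU t.2.1)
    rw [ddz_res] at h1 h2
    simp only [Transf.compHom_apply, transport_apply, coeffsLie, mulBy, dz_apply,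
      LinearMap.prodMap_apply, LinearMap.mulLeft_apply, Prod.fst_sub, Transf.comp_sub,
      Transf.comp_mul, Φ.comp_symm, res_sub, res_mul]
    linear_combination (- res hVU s.1) * h2 + res hVU t.1 * h1
  · have h1 := hd (res hVU s.2.2)
    have h2 := hd (res hVU t.2.2)
    rw [ddz_res] at h1 h2
    simp only [Transf.compHom_apply, transport_apply, coeffsLie, mulBy, dz_apply,
      LinearMap.prodMap_apply, LinearMap.mulLeft_apply, Prod.snd_sub, Transf.comp_sub,
      Transf.comp_mul, Φ.comp_symm, res_sub, res_mul]
    linear_combination (- res hVU s.1) * h2 + res hVU t.1 * h1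

theorem LieClosed.map_transport {L : Submodule ℂ (Coeffs U)} (hL : LieClosed L)
    (Φ : Transf V W) (hVU : V ≤ U) : LieClosed (L.map (Φ.transport hVU)) := by
  rintro _ ⟨s, hs, rfl⟩ _ ⟨t, ht, rfl⟩
  exact ⟨_, hL s hs t ht, Φ.transport_coeffsLie hVU s t⟩

theorem Transf.pull_injective (Φ : Transf V W) : Function.Injective Φ.pull := by
  intro F G h
  have h1 := congrArg Prod.fst h
  have h2 := congrArg Prod.snd h
  simp only [Transf.pull] at h1 h2
  exact Prod.ext (Φ.compHom_bijective.1 (Φ.α⁻¹.isUnit.mul_left_cancel h1))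
    (Φ.compHom_bijective.1 ((Φ.α⁻¹.isUnit.mul Φ.β.isUnit).mul_left_cancel h2))

/-- The three conditions are the transformation rules of the coefficients with denominators cleared.
Uniqueness of `T'` comes from injectivity of `pull`. -/
theorem Transf.carries_evenOp_iff (Φ : Transf V W) {f g h : Hol V} {f' g' h' : Hol W}
    (hf : Φ.comp f' = ddz V Φ.φ * f) (hg : Φ.β * (Φ.comp g' - g) = f * ddz V Φ.β)
    (hh : Φ.α * (Φ.comp h' - h) = - (f * ddz V Φ.α)) (T' : Module.End ℂ (SFun W)) :
    Φ.Carries (evenOp f g h) T' ↔ T' = evenOp f' g' h' := by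
  have key : Φ.Carries (evenOp f g h) (evenOp f' g' h') := by
    intro F
    have ha : (Φ.α : Hol V) * ((Φ.α⁻¹ : (Hol V)ˣ) : Hol V) = 1 := Φ.α.mul_inv
    have hda := congrArg (ddz V) ha
    rw [Derivation.leibniz, Derivation.map_one_eq_zero, smul_eq_mul, smul_eq_mul] at hda
    simp only [Transf.pull, evenOp_apply, ← Transf.compHom_apply, map_add, map_mul,
      Derivation.leibniz, smul_eq_mul]
    simp only [Transf.compHom_apply, Φ.ddz_comp, hf]
    set a := ((Φ.α⁻¹ : (Hol V)ˣ) : Hol V)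
    have hh' : a * (Φ.comp h' - h) = f * ddz V a := by
      linear_combination a * a * hh - a * (Φ.comp h' - h) * ha - a * f * hda
        + (f * ddz V a) * ha
    refine Prod.ext ?_ ?_
    · dsimp only
      linear_combination Φ.comp F.1 * hh'
    · dsimp only
      linear_combination Φ.comp F.2 * Φ.β * hh' + a * Φ.comp F.2 * hg
  constructor
  · intro h1
    exact LinearMap.ext fun F => Φ.pull_injective ((h1 F).trans (key F).symm)
  · rintro rfl
    exact key

/-- The change of variable of `Φ`, with the factors `β` and `α` given on the target. -/
def Transf.withFactors (Φ : Transf V W) (β α : (Hol W)ˣ) : Transf V W :=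
  { Φ with
    β := Units.map Φ.compHom β
    α := Units.map Φ.compHom α }

/-- The coefficients of the elements of `l`. -/
def coeffsOf (l : LieSubalgebra ℂ (Module.End ℂ (SFun U))) : Submodule ℂ (Coeffs U) :=
  l.toSubmodule.comap (evenHom U)

theorem lieClosed_coeffsOf (l : LieSubalgebra ℂ (Module.End ℂ (SFun U))) :
    LieClosed (coeffsOf l) := by
  intro s hs t ht
  change evenHom U (coeffsLie s t) ∈ l
  rw [← lie_evenHom]
  exact l.lie_mem hs ht

theorem finiteDimensional_coeffsOf (l : LieSubalgebra ℂ (Module.End ℂ (SFun U)))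
    [hl : FiniteDimensional ℂ l] : FiniteDimensional ℂ (coeffsOf l) :=
  haveI : FiniteDimensional ℂ l.toSubmodule := hl
  finiteDimensional_comap (evenHom_injective U) l.toSubmodule

/-- The substitution `θ̄ = β θ` adds `f β'/β` to `g`, while conjugation by `α` adds `-f α'/α` to
`h`; hence the opposite signs in the two differential equations. -/
theorem Transf.carriesAlgebra_withFactors (Φ : Transf V W) (hVU : V ≤ U) {β α : (Hol W)ˣ}
    {ξ : SFun W} (hβ : ddz W (β : Hol W) = ξ.1 * β) (hα : ddz W (α : Hol W) = - (ξ.2 * α))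
    (l : LieSubalgebra ℂ (Module.End ℂ (SFun U))) :
    (Φ.withFactors β α).CarriesAlgebra hVU l
      ((((coeffsOf l).map (Φ.transport hVU)).map (gauge ξ)).map (evenHom W)) := by
  have key : ∀ (t : Coeffs U) (T' : Module.End ℂ (SFun W)),
      (Φ.withFactors β α).Carries (evenOp (res hVU t.1) (res hVU t.2.1) (res hVU t.2.2)) T' ↔
        T' = evenHom W (gauge ξ (Φ.transport hVU t)) := by
    intro t T'
    refine (Φ.withFactors β α).carries_evenOp_iff (Φ.comp_symm _) ?_ ?_ T'
    · change Φ.comp β * (Φ.compHom (_ + _ * ξ.1) - _) = _ * ddz V (Φ.comp β)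
      rw [Φ.ddz_comp, hβ, map_add, map_mul, ← Φ.compHom_apply (ξ.1 * β), map_mul]
      simp only [Transf.compHom_apply, Φ.transport_apply, Φ.comp_symm]
      ring
    · change Φ.comp α * (Φ.compHom (_ + _ * ξ.2) - _) = - (_ * ddz V (Φ.comp α))
      rw [Φ.ddz_comp, hα, map_add, map_mul, ← Φ.compHom_apply (-(ξ.2 * α)), map_neg, map_mul]
      simp only [Transf.compHom_apply, Φ.transport_apply, Φ.comp_symm]
      ring
  intro T'
  constructor
  · rintro ⟨_, ⟨_, ⟨t, ht, rfl⟩, rfl⟩, rfl⟩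
    exact ⟨t.1, t.2.1, t.2.2, ht, (key t _).2 rfl⟩
  · rintro ⟨f, g, h, ht, hc⟩
    exact ⟨_, ⟨_, ⟨(f, g, h), ht, rfl⟩, rfl⟩, ((key (f, g, h) T').1 hc).symm⟩

/-- Local existence of a change of variable with a prescribed function `φ`. -/
theorem exists_transf (φ : Hol U) (p : U) (hp : (ddz U φ).1 p ≠ 0) :
    ∃ (V W : Opens ℂ) (hVU : V ≤ U) (Φ : Transf V W), (p : ℂ) ∈ V ∧
      (∃ c r, 0 < r ∧ (W : Set ℂ) = Metric.ball c r) ∧ Φ.φ = res hVU φ := by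
  set F := ext0 φ.1
  have hF : HasStrictDerivAt F ((ddz U φ).1 p) p := (φ.2 p p.2).hasStrictDerivAt
  set e := (hF.hasStrictFDerivAt_equiv hp).toOpenPartialHomeomorph F
  have hpe : (p : ℂ) ∈ e.source :=
    (hF.hasStrictFDerivAt_equiv hp).mem_toOpenPartialHomeomorph_source
  have hO : IsOpen ((U : Set ℂ) ∩ deriv F ⁻¹' {0}ᶜ) :=
    (AnalyticOnNhd.deriv φ.2).continuousOn.isOpen_inter_preimage U.isOpen isOpen_compl_singleton
  have hS : IsOpen (e.source ∩ ((U : Set ℂ) ∩ deriv F ⁻¹' {0}ᶜ)) := e.open_source.inter hO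
  have hFS : F '' (e.source ∩ ((U : Set ℂ) ∩ deriv F ⁻¹' {0}ᶜ)) ∈ nhds (F p) := by
    rw [← hF.map_nhds_eq hp]
    exact Filter.image_mem_map (hS.mem_nhds ⟨hpe, p.2, hp⟩)
  -- `V` is cut down to the part lying over a ball inside the image, so that the target is a full
  -- ball.
  obtain ⟨r, hr, hball⟩ := Metric.mem_nhds_iff.1 hFS
  set V : Opens ℂ := ⟨(e.source ∩ F ⁻¹' Metric.ball (F p) r) ∩ ((U : Set ℂ) ∩ deriv F ⁻¹' {0}ᶜ),
    (e.isOpen_inter_preimage Metric.isOpen_ball).inter hO⟩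
  have hVU : V ≤ U := fun z hz => hz.2.1
  have hmaps : ∀ z : V, (res hVU φ).1 z ∈ (⟨Metric.ball (F p) r, Metric.isOpen_ball⟩ : Opens ℂ) :=
    fun z => z.2.1.2
  refine ⟨V, ⟨Metric.ball (F p) r, Metric.isOpen_ball⟩, hVU,
    { φ := res hVU φ, mapsTo := hmaps, bijective := ⟨?_, ?_⟩, deriv_ne := fun z => ?_,
      β := 1, α := 1 }, ⟨⟨hpe, Metric.mem_ball_self hr⟩, p.2, hp⟩, ⟨_, r, hr, rfl⟩, rfl⟩
  · intro z w h
    exact Subtype.ext (e.injOn z.2.1.1 w.2.1.1 (congrArg Subtype.val h))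
  · rintro ⟨w, hw⟩
    obtain ⟨z, hz, rfl⟩ := hball hw
    exact ⟨⟨z, ⟨hz.1, hw⟩, hz.2⟩, rfl⟩
  · rw [ddz_res, res_apply]
    exact z.2.2.2

/-! ### Normal forms up to gauge -/

theorem mulBy_apply (f : Hol W) (x : SFun W) : mulBy f x = (f * x.1, f * x.2) := rfl

theorem dz_mulBy (f : Hol W) (x : SFun W) :
    dz W (mulBy f x) = mulBy (ddz W f) x + mulBy f (dz W x) := by
  refine Prod.ext ?_ ?_ <;>
  · simp only [dz_apply, mulBy_apply, Derivation.leibniz, smul_eq_mul, Prod.fst_add, Prod.snd_add]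
    ring

theorem mulBy_one (x : SFun W) : mulBy 1 x = x := by simp [mulBy_apply]

theorem mulBy_zero (x : SFun W) : mulBy 0 x = 0 := by simp [mulBy_apply]

theorem dz_eq_evenHom : dz W = evenHom W (1, 0) :=
  LinearMap.ext fun F => by simp [evenHom_apply, evenOp_apply, dz_apply]

theorem evenHom_inr (x : SFun W) : evenHom W (0, x) = aOpHom W x := rfl

/-- The multiplicative part of a space of coefficients. -/
def kerPart (L : Submodule ℂ (Coeffs W)) : Submodule ℂ (SFun W) :=
  L.comap (LinearMap.inr ℂ (Hol W) (SFun W))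

theorem mem_kerPart {L : Submodule ℂ (Coeffs W)} {x : SFun W} :
    x ∈ kerPart L ↔ ((0 : Hol W), x) ∈ L := Iff.rfl

instance (L : Submodule ℂ (Coeffs W)) [FiniteDimensional ℂ L] :
    FiniteDimensional ℂ (kerPart L) :=
  finiteDimensional_comap LinearMap.inr_injective L

theorem sub_mem_kerPart {L : Submodule ℂ (Coeffs W)} {f : Hol W} {x y : SFun W}
    (hx : (f, x) ∈ L) (hy : (f, y) ∈ L) : x - y ∈ kerPart L := by
  simpa [mem_kerPart] using L.sub_mem hx hy

theorem add_mem_of_mem_kerPart {L : Submodule ℂ (Coeffs W)} {f : Hol W} {x y : SFun W}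
    (hx : (f, x) ∈ L) (hy : y ∈ kerPart L) : (f, x + y) ∈ L := by
  simpa using L.add_mem hx (mem_kerPart.1 hy)

/-- Multiplicative operators commute with each other, so the bracket with `f ∂_z + x` acts on them
as `f d/dz`, whatever the tail `x` is. -/
theorem LieClosed.mulBy_dz_mem {L : Submodule ℂ (Coeffs W)} (hL : LieClosed L) {f : Hol W}
    {x : SFun W} (hf : (f, x) ∈ L) : ∀ a ∈ kerPart L, mulBy f (dz W a) ∈ kerPart L := by
  intro a ha
  have h := hL _ hf _ (mem_kerPart.1 ha)
  simpa [mem_kerPart, coeffsLie, mulBy_zero] using h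

theorem LieClosed.dz_mem {L : Submodule ℂ (Coeffs W)} (hL : LieClosed L)
    {x : SFun W} (hx : ((1 : Hol W), x) ∈ L) : ∀ a ∈ kerPart L, dz W a ∈ kerPart L := by
  intro a ha
  simpa only [mulBy_one] using hL.mulBy_dz_mem hx a ha

/-- Since `S` realises every vector field part, an element of `L` differs from a combination of `S`
by a multiplicative operator. The last three normal forms are read off from this splitting. -/
theorem map_evenHom_eq {L : Submodule ℂ (Coeffs W)} {S : Set (Coeffs W)} (hS : S ⊆ L)
    (hL : ∀ t ∈ L, ∃ s ∈ Submodule.span ℂ S, s.1 = t.1) :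
    L.map (evenHom W) =
      Submodule.span ℂ (evenHom W '' S) ⊔ (kerPart L).map (aOpHom W) := by
  have h1 : L = Submodule.span ℂ S ⊔ (kerPart L).map (LinearMap.inr ℂ (Hol W) (SFun W)) := by
    refine le_antisymm (fun t ht => ?_) (sup_le (Submodule.span_le.2 hS)
      (Submodule.map_comap_le _ _))
    obtain ⟨s, hs, hst⟩ := hL t ht
    have h2 : t - s = (0, t.2 - s.2) := Prod.ext (by simp [hst]) rfl
    have h3 := L.sub_mem ht (Submodule.span_le.2 hS hs)
    rw [← add_sub_cancel s t]
    refine Submodule.add_mem_sup hs ⟨t.2 - s.2, ?_, h2.symm⟩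
    rw [h2] at h3
    exact h3
  conv_lhs => rw [h1]
  rw [Submodule.map_sup, Submodule.map_span, ← Submodule.map_comp]
  rfl

theorem isForm1_of_mem (hW : IsConnected (W : Set ℂ)) {L : Submodule ℂ (Coeffs W)}
    [FiniteDimensional ℂ L] (hL : LieClosed L) (h1 : ((1 : Hol W), (0 : SFun W)) ∈ L)
    (hF : ∀ t ∈ L, t.1 ∈ Submodule.span ℂ {(1 : Hol W)}) : IsForm1 (L.map (evenHom W)) := by
  obtain ⟨M, a, b, r, c, hc, hM⟩ :=
    exists_map_aOpHom_eq_bimodule hW (kerPart L) (hL.dz_mem h1)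
  refine ⟨M, a, b, r, c, hc, ?_, ?_⟩
  · rw [← hM]
    refine ⟨inferInstance, ?_, ?_⟩
    · rintro _ ⟨x, -, rfl⟩
      exact ⟨x.1, x.2, rfl⟩
    · rintro _ ⟨x, hx, rfl⟩
      refine ⟨dz W x, hL.dz_mem h1 x hx, ?_⟩
      have h := lie_evenHom ((1 : Hol W), (0 : SFun W)) (0, x)
      rw [← dz_eq_evenHom, evenHom_inr] at h
      rw [h, ← evenHom_inr]
      congr 1
      simp [coeffsLie, mulBy_one]
  · rw [← hM, map_evenHom_eq (S := {(1, 0)}) (by simpa using h1), Set.image_singleton,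
      ← dz_eq_evenHom]
    intro t ht
    obtain ⟨c, hc⟩ := Submodule.mem_span_singleton.1 (hF t ht)
    exact ⟨c • (1, 0), Submodule.smul_mem _ _ (Submodule.mem_span_singleton_self _), hc⟩

theorem exists_eq_const_of_dz_eq_zero (hW : IsPreconnected (W : Set ℂ)) {κ : SFun W}
    (hκ : dz W κ = 0) : ∃ α β : ℂ, κ = (α • (1 : Hol W), β • (1 : Hol W)) := by
  obtain ⟨α, hα⟩ := exists_eq_smul_one_of_ddz_eq_zero hW (congrArg Prod.fst hκ)
  obtain ⟨β, hβ⟩ := exists_eq_smul_one_of_ddz_eq_zero hW (congrArg Prod.snd hκ)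
  exact ⟨α, β, Prod.ext hα hβ⟩

theorem mon_zero (W : Opens ℂ) : mon W 0 = 1 := by rw [mon_eq_pow, pow_zero]

theorem derivative_mem_comap_expPair_zero_of_mulBy {A : Submodule ℂ (SFun W)} {k : ℕ}
    (hE : ∀ x ∈ A, mulBy (mon W k) (dz W x) ∈ A) :
    ∀ x ∈ A.comap (expPair W 0), (X ^ k * derivative x.1, X ^ k * derivative x.2) ∈
      A.comap (expPair W 0) := by
  intro x hx
  have h1 := hE _ hx
  rw [Submodule.mem_comap]
  convert h1 using 1
  simp only [expPair_zero_apply, mulBy_apply, dz_apply, ddz_polyHol, map_mul, polyHol_X_pow]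

theorem isForm2_of_mem (hW : IsConnected (W : Set ℂ)) {L : Submodule ℂ (Coeffs W)}
    [FiniteDimensional ℂ L] (hL : LieClosed L) (h1 : ((1 : Hol W), (0 : SFun W)) ∈ L)
    {κ : SFun W} (hκ : dz W κ = 0) (hz : (mon W 1, κ) ∈ L)
    (hF : ∀ t ∈ L, t.1 ∈ Submodule.span ℂ {(1 : Hol W), mon W 1}) :
    IsForm2 (L.map (evenHom W)) := by
  obtain ⟨α, β, rfl⟩ := exists_eq_const_of_dz_eq_zero hW.isPreconnected hκ
  have hfin : FiniteDimensional ℂ ((kerPart L).comap (expPair W 0)) :=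
    finiteDimensional_comap (expPair_injective hW.nonempty 0) _
  obtain ⟨a, b, r, c, hc, hab, hP⟩ := exists_eq_span_gradedGens ((kerPart L).comap (expPair W 0))
    (derivative_mem_comap_expPair (hL.dz_mem h1) 0) (by
      simpa only [pow_one] using
        derivative_mem_comap_expPair_zero_of_mulBy (hL.mulBy_dz_mem hz))
  have hA := eq_map_expPair_zero hW (kerPart L) (hL.dz_mem h1) (hL.mulBy_dz_mem hz)
  refine ⟨α, β, c, a, b, r, hc, hab, ?_⟩
  have hbi : (kerPart L).map (aOpHom W) = bimodule₀ W a b r c := by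
    rw [hA, hP, Submodule.map_span, Submodule.map_span, bimodule₀, gradedGens]
    congr 1
    ext T
    simp only [Set.image_union, Set.mem_union]
    constructor
    · rintro ((⟨_, ⟨_, ⟨k, hk, rfl⟩, rfl⟩, rfl⟩ | ⟨_, ⟨_, ⟨k, hk, rfl⟩, rfl⟩, rfl⟩) |
        ⟨_, ⟨_, ⟨k, hk, rfl⟩, rfl⟩, rfl⟩)
      · refine Or.inl (Or.inl ⟨k, hk, ?_⟩)
        simp only [aOpHom_apply, expPair_zero_apply, polyHol_X_pow, map_zero]
      · refine Or.inl (Or.inr ⟨k, hk, ?_⟩)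
        simp only [aOpHom_apply, expPair_zero_apply, polyHol_X_pow, map_zero]
      · refine Or.inr ⟨k, hk, ?_⟩
        simp only [aOpHom_apply, expPair_zero_apply, polyHol_X_pow, map_smul]
    · rintro ((⟨k, hk, rfl⟩ | ⟨k, hk, rfl⟩) | ⟨k, hk, rfl⟩)
      · refine Or.inl (Or.inl ⟨_, ⟨_, ⟨k, hk, rfl⟩, rfl⟩, ?_⟩)
        simp only [aOpHom_apply, expPair_zero_apply, polyHol_X_pow, map_zero]
      · refine Or.inl (Or.inr ⟨_, ⟨_, ⟨k, hk, rfl⟩, rfl⟩, ?_⟩)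
        simp only [aOpHom_apply, expPair_zero_apply, polyHol_X_pow, map_zero]
      · refine Or.inr ⟨_, ⟨_, ⟨k, hk, rfl⟩, rfl⟩, ?_⟩
        simp only [aOpHom_apply, expPair_zero_apply, polyHol_X_pow, map_smul]
  rw [map_evenHom_eq (S := {(1, 0), (mon W 1, (α • 1, β • 1))}), hbi, Set.image_pair,
    ← dz_eq_evenHom]
  · rfl
  · rintro _ (rfl | rfl)
    exacts [h1, hz]
  · intro t ht
    have h2 : Submodule.span ℂ {(1 : Hol W), mon W 1} = (Submodule.span ℂ
        {((1 : Hol W), (0 : SFun W)), (mon W 1, (α • 1, β • 1))}).map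
          (LinearMap.fst ℂ (Hol W) (SFun W)) := by
      rw [Submodule.map_span, Set.image_pair]; rfl
    have h3 := hF t ht
    rw [h2] at h3
    exact h3

/-- Invariance under `d/dz` and `z² d/dz` makes the multiplicative part constant. The brackets of
`z² ∂_z + ζ` with the other two generators then show how to correct the tails `κ` and `ζ` by
elements of that part. -/
theorem isForm3_of_mem (hW : IsConnected (W : Set ℂ)) {L : Submodule ℂ (Coeffs W)}
    [FiniteDimensional ℂ L] (hL : LieClosed L) (h1 : ((1 : Hol W), (0 : SFun W)) ∈ L)
    {κ ζ : SFun W} (hκ : dz W κ = 0) (hz : (mon W 1, κ) ∈ L) (hz2 : (mon W 2, ζ) ∈ L)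
    (hF : ∀ t ∈ L, t.1 ∈ Submodule.span ℂ {(1 : Hol W), mon W 1, mon W 2}) :
    IsForm3 (L.map (evenHom W)) := by
  have hfin : FiniteDimensional ℂ ((kerPart L).comap (expPair W 0)) :=
    finiteDimensional_comap (expPair_injective hW.nonempty 0) _
  obtain ⟨γ, S, hS, hP⟩ := exists_eq_span_of_invariant_sq ((kerPart L).comap (expPair W 0))
    (derivative_mem_comap_expPair (hL.dz_mem h1) 0)
    (derivative_mem_comap_expPair_zero_of_mulBy (hL.mulBy_dz_mem hz2))
  have hA := eq_map_expPair_zero hW (kerPart L) (hL.dz_mem h1) (hL.mulBy_dz_mem hz)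
  rw [hP, Submodule.map_span] at hA
  have hconst : ∀ a ∈ kerPart L, dz W a = 0 := by
    intro a ha
    rw [hA] at ha
    have : Submodule.span ℂ (expPair W 0 '' S) ≤ LinearMap.ker (dz W) := by
      rw [Submodule.span_le]
      rintro _ ⟨x, hx, rfl⟩
      rw [SetLike.mem_coe, LinearMap.mem_ker, dz_expPair, zero_smul, add_zero]
      rcases hS hx with rfl | rfl <;> simp [expPair_apply]
    exact this ha
  have hd1 : ddz W (mon W 2) = (2 : ℂ) • mon W 1 := by
    rw [mon_eq_pow W 2, Derivation.leibniz_pow, ddz_mon_one]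
    simp [two_smul]
  have hm2 : mon W 2 = mon W 1 * mon W 1 := by rw [mon_eq_pow W 2, sq]
  have he : dz W ζ - (2 : ℂ) • κ ∈ kerPart L := by
    refine sub_mem_kerPart (f := (2 : ℂ) • mon W 1) ?_ (L.smul_mem (2 : ℂ) hz)
    have h := hL _ h1 _ hz2
    simpa [coeffsLie, hd1, mulBy_one] using h
  have hd : mulBy (mon W 1) (dz W ζ) - ζ ∈ kerPart L := by
    refine sub_mem_kerPart (f := mon W 2) ?_ hz2
    have h := hL _ hz _ hz2
    convert h using 1
    refine Prod.ext ?_ ?_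
    · simp only [coeffsLie, hd1, ddz_mon_one, two_smul]
      rw [hm2]
      ring
    · simp [coeffsLie, hκ]
  -- After correction the tails are `ζ'/2` and `z ζ'`, where `ζ' = 2κ + e` is constant; this gives
  -- `α, β` and the doubled constants.
  set e := dz W ζ - (2 : ℂ) • κ with he_def
  have hz' : (mon W 1, κ + (2⁻¹ : ℂ) • e) ∈ L :=
    add_mem_of_mem_kerPart hz ((kerPart L).smul_mem _ he)
  have hz2' := add_mem_of_mem_kerPart hz2 hd
  have hκ' : dz W (κ + (2⁻¹ : ℂ) • e) = 0 := by
    rw [map_add, map_smul, hκ, hconst e he, smul_zero, add_zero]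
  obtain ⟨α, β, hαβ⟩ := exists_eq_const_of_dz_eq_zero hW.isPreconnected hκ'
  have hζ : dz W ζ = ((2 * α) • (1 : Hol W), (2 * β) • (1 : Hol W)) := by
    have h4 : dz W ζ = (2 : ℂ) • (κ + (2⁻¹ : ℂ) • e) := by
      rw [he_def, smul_add, smul_smul]
      norm_num
    rw [h4, hαβ, Prod.smul_mk, smul_smul, smul_smul]
  rw [add_sub_cancel, hζ, mulBy_apply] at hz2'
  rw [hαβ] at hz'
  simp only [mul_smul_comm, mul_one] at hz2'
  refine ⟨α, β, γ, aOpHom W '' (expPair W 0 '' S), ?_, ?_⟩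
  · rintro _ ⟨_, ⟨x, hx, rfl⟩, rfl⟩
    rcases hS hx with rfl | rfl
    · left
      rw [aOpHom_apply, expPair_zero_apply, ← mul_one (C γ), ← smul_eq_C_mul, map_smul, map_one]
    · right
      rw [aOpHom_apply, expPair_zero_apply, map_one, map_zero]; rfl
  · rw [map_evenHom_eq (S := {(1, 0), (mon W 1, (α • 1, β • 1)),
      (mon W 2, ((2 * α) • mon W 1, (2 * β) • mon W 1))}), hA, Submodule.map_span,
      Submodule.span_union, Set.image_insert_eq, Set.image_pair, ← dz_eq_evenHom]
    · rfl
    · rintro _ (rfl | rfl | rfl)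
      exacts [h1, hz', hz2']
    · intro t ht
      have h2 : Submodule.span ℂ {(1 : Hol W), mon W 1, mon W 2} = (Submodule.span ℂ
          {((1 : Hol W), (0 : SFun W)), (mon W 1, (α • 1, β • 1)),
            (mon W 2, ((2 * α) • mon W 1, (2 * β) • mon W 1))}).map
            (LinearMap.fst ℂ (Hol W) (SFun W)) := by
        rw [Submodule.map_span, Set.image_insert_eq, Set.image_pair]; rfl
      have h3 := hF t ht
      rw [h2] at h3
      exact h3

theorem gauge_mem_map_gauge {L : Submodule ℂ (Coeffs W)} (ξ : SFun W) {f : Hol W} {x : SFun W}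
    (h : (f, x) ∈ L) : (f, x + mulBy f ξ) ∈ L.map (gauge ξ) := ⟨_, h, rfl⟩

/-- A space of coefficients which contains `∂_z` and `z ∂_z` up to multiplicative terms can be
gauged so that these terms become `0` and a constant. -/
theorem exists_gauge (hW : IsConnected (W : Set ℂ)) {L : Submodule ℂ (Coeffs W)}
    [FiniteDimensional ℂ L] (hL : LieClosed L) {x y : SFun W} (h1 : ((1 : Hol W), x) ∈ L)
    (hz : (mon W 1, y) ∈ L) :
    ∃ ξ κ : SFun W, dz W κ = 0 ∧ ((1 : Hol W), (0 : SFun W)) ∈ L.map (gauge ξ) ∧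
      (mon W 1, κ) ∈ L.map (gauge ξ) := by
  have hA := eq_map_expPair_zero hW (kerPart L) (hL.dz_mem h1) (hL.mulBy_dz_mem hz)
  have hE : ∀ a ∈ kerPart L, (dz W ∘ₗ mulBy (mon W 1)) a ∈ kerPart L := by
    intro a ha
    rw [LinearMap.comp_apply, dz_mulBy, ddz_mon_one, mulBy_one]
    exact (kerPart L).add_mem ha (hL.mulBy_dz_mem hz a ha)
  -- The multiplicative part consists of pairs of polynomials, and `z p` is constant only for `p =
  -- 0`. In finite dimension injectivity of `a ↦ (z a)'` gives surjectivity.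
  have hinj : Function.Injective ((dz W ∘ₗ mulBy (mon W 1)).restrict hE) := by
    rw [injective_iff_map_eq_zero]
    rintro ⟨a, ha⟩ h
    have h0 : dz W (mulBy (mon W 1) a) = 0 := congrArg Subtype.val h
    obtain ⟨α, β, hαβ⟩ := exists_eq_const_of_dz_eq_zero hW.isPreconnected h0
    rw [hA] at ha
    obtain ⟨q, -, rfl⟩ := ha
    have hq : ∀ (p : ℂ[X]) (c : ℂ), mon W 1 * polyHol W p = c • (1 : Hol W) → p = 0 := by
      intro p c hpc
      have : X * p = c • 1 := polyHol_injective hW.nonempty (by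
        rw [map_mul, polyHol_X, hpc, map_smul, map_one])
      ext n
      have h2 := congrArg (fun r => coeff r (n + 1)) this
      simpa [coeff_one] using h2
    rw [expPair_zero_apply, mulBy_apply] at hαβ
    have h3 : q = 0 := Prod.ext (hq _ _ (congrArg Prod.fst hαβ)) (hq _ _ (congrArg Prod.snd hαβ))
    exact Subtype.ext (by simp [h3])
  -- The bracket of the two elements is again a lift of `∂_z`; its tail differs from `x` by exactly
  -- this derivative.
  have hu : dz W (y - mulBy (mon W 1) x) ∈ kerPart L := by
    have h := hL _ h1 _ hz
    have h' : ((1 : Hol W), dz W y - mulBy (mon W 1) (dz W x)) ∈ L := by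
      simpa [coeffsLie, ddz_mon_one, mulBy_one] using h
    have h2 := sub_mem_kerPart h' h1
    rw [map_sub, dz_mulBy, ddz_mon_one, mulBy_one]
    convert h2 using 1
    abel
  obtain ⟨⟨v, hv⟩, hvu⟩ := (LinearMap.injective_iff_surjective (K := ℂ) (V := kerPart L)
    (f := (dz W ∘ₗ mulBy (mon W 1)).restrict hE)).1 hinj ⟨_, hu⟩
  replace hvu : dz W (mulBy (mon W 1) v) = dz W (y - mulBy (mon W 1) x) := congrArg Subtype.val hvu
  -- Replacing the lift `∂_z + x` by `∂_z + x + v` and gauging its tail away leaves `y - z (x + v)`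
  -- on `z ∂_z`; its derivative vanishes by the choice of `v`.
  refine ⟨-(x + v), y + mulBy (mon W 1) (-(x + v)), ?_, ?_, gauge_mem_map_gauge _ hz⟩
  · rw [map_neg, map_add, map_add, map_neg, map_add, hvu, map_sub]
    abel
  · have h := gauge_mem_map_gauge (-(x + v)) (add_mem_of_mem_kerPart h1 hv)
    rwa [mulBy_one, add_neg_cancel] at h

theorem map_gauge_fst_mem {L : Submodule ℂ (Coeffs W)} {Q : Submodule ℂ (Hol W)}
    (h : ∀ t ∈ L, t.1 ∈ Q) (ξ : SFun W) : ∀ t ∈ L.map (gauge ξ), t.1 ∈ Q := by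
  rintro _ ⟨t, ht, rfl⟩
  exact h t ht

/-- The vector field parts of a finite-dimensional Lie algebra containing `∂_z` and `z ∂_z` are
spanned by `1, z` or by `1, z, z²`. -/
theorem fst_mem_span (hW : IsConnected (W : Set ℂ)) {L : Submodule ℂ (Coeffs W)}
    [FiniteDimensional ℂ L] (hL : LieClosed L) {x y : SFun W} (h1 : ((1 : Hol W), x) ∈ L)
    (hz : (mon W 1, y) ∈ L) :
    (∀ t ∈ L, t.1 ∈ Submodule.span ℂ {(1 : Hol W), mon W 1}) ∨
    ((∀ t ∈ L, t.1 ∈ Submodule.span ℂ {(1 : Hol W), mon W 1, mon W 2}) ∧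
      ∃ ζ, (mon W 2, ζ) ∈ L) := by
  set F := L.map (LinearMap.fst ℂ (Hol W) (SFun W))
  have hmem : ∀ s ∈ F, ∀ t ∈ F, s * ddz W t - t * ddz W s ∈ F := by
    rintro _ ⟨s, hs, rfl⟩ _ ⟨t, ht, rfl⟩
    exact ⟨_, hL s hs t ht, rfl⟩
  have h1F : (1 : Hol W) ∈ F := ⟨_, h1, rfl⟩
  have hzF : mon W 1 ∈ F := ⟨_, hz, rfl⟩
  have hD : ∀ f ∈ F, ddz W f ∈ F := fun f hf => by simpa using hmem _ h1F f hf
  have hE : ∀ f ∈ F, mon W 1 * ddz W f ∈ F := fun f hf => by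
    have := F.add_mem (hmem _ hzF f hf) hf
    simpa [ddz_mon_one] using this
  -- Paired with a zero second component, `F` falls under the result on pairs of functions.
  have hA := eq_map_expPair_zero hW (F.map (LinearMap.inl ℂ (Hol W) (Hol W)))
    (by rintro _ ⟨f, hf, rfl⟩; exact ⟨_, hD f hf, by simp [dz_apply]⟩)
    (by rintro _ ⟨f, hf, rfl⟩; exact ⟨_, hE f hf, by simp [dz_apply, mulBy_apply]⟩)
  have hpoly : ∀ f ∈ F, ∃ p, f = polyHol W p := by
    intro f hf
    have h2 : (f, (0 : Hol W)) ∈ F.map (LinearMap.inl ℂ (Hol W) (Hol W)) := ⟨f, hf, rfl⟩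
    rw [hA] at h2
    obtain ⟨q, -, hq⟩ := h2
    rw [expPair_zero_apply] at hq
    exact ⟨q.1, (congrArg Prod.fst hq).symm⟩
  have hfin : FiniteDimensional ℂ (F.comap (polyHol W).toLinearMap) :=
    finiteDimensional_comap (polyHol_injective hW.nonempty) F
  obtain ⟨n, hn⟩ := exists_eq_degreeLT (F.comap (polyHol W).toLinearMap) (fun p hp => by
    have := hD _ hp
    rw [AlgHom.toLinearMap_apply, ddz_polyHol] at this
    exact this)
  have hX : ∀ k, mon W k ∈ F ↔ k < n := fun k => by
    rw [← X_pow_mem_degreeLT, ← hn, Submodule.mem_comap, AlgHom.toLinearMap_apply, polyHol_X_pow]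
  have hle : ∀ t ∈ L, ∃ p ∈ degreeLT ℂ n, t.1 = polyHol W p := by
    intro t ht
    have htF : t.1 ∈ F := ⟨t, ht, rfl⟩
    obtain ⟨p, hp⟩ := hpoly _ htF
    refine ⟨p, ?_, hp⟩
    rw [← hn, Submodule.mem_comap, AlgHom.toLinearMap_apply, ← hp]
    exact htF
  have hn2 : 1 < n := (hX 1).1 hzF
  have hn3 : n < 4 := by
    -- The bracket of `z^{n-1}` and `z^{n-2}` is `-z^{2n-4}`, and `2n - 4 ≥ n` as soon as `n ≥ 4`.
    by_contra! h4
    obtain ⟨m, rfl⟩ : ∃ m, n = m + 4 := ⟨n - 4, by omega⟩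
    have h5 := hmem _ ((hX (m + 3)).2 (by omega)) _ ((hX (m + 2)).2 (by omega))
    have h6 : mon W (m + 3) * ddz W (mon W (m + 2)) - mon W (m + 2) * ddz W (mon W (m + 3)) =
        - mon W (m + 3 + (m + 1)) := by
      simp only [mon_eq_pow W (m + 3), mon_eq_pow W (m + 2), mon_eq_pow W (m + 3 + (m + 1)),
        Derivation.leibniz_pow, ddz_mon_one, smul_eq_mul, mul_one, nsmul_eq_mul]
      push_cast
      ring
    rw [h6, neg_mem_iff, hX] at h5
    omega
  have hspan : ∀ Q : Submodule ℂ (Hol W), (∀ k < n, mon W k ∈ Q) → ∀ t ∈ L, t.1 ∈ Q := by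
    intro Q hQ t ht
    obtain ⟨p, hp, hpt⟩ := hle t ht
    have : degreeLT ℂ n ≤ Q.comap (polyHol W).toLinearMap :=
      degreeLT_le_of_X_pow_mem fun k hk => by
        rw [Submodule.mem_comap, AlgHom.toLinearMap_apply, polyHol_X_pow]; exact hQ k hk
    rw [hpt]
    exact this hp
  obtain rfl | rfl : n = 2 ∨ n = 3 := by omega
  · left
    refine hspan _ fun k hk => Submodule.subset_span ?_
    interval_cases k
    · simp [mon_zero]
    · simp
  · right
    refine ⟨hspan _ fun k hk => Submodule.subset_span ?_, ?_⟩
    · interval_cases k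
      · simp [mon_zero]
      · simp
      · simp
    · obtain ⟨t, ht, h2⟩ := (hX 2).2 (by omega)
      exact ⟨t.2, by rw [← h2]; exact ht⟩

/-- Normal form, up to gauge, of a finite-dimensional Lie algebra whose vector field parts contain
`∂_z`, and contain also `z ∂_z` unless they are all multiples of `∂_z`. -/
theorem exists_gauge_isForm (hW : IsConnected (W : Set ℂ)) {L : Submodule ℂ (Coeffs W)}
    [FiniteDimensional ℂ L] (hL : LieClosed L) {x : SFun W} (h1 : ((1 : Hol W), x) ∈ L)
    (hF : (∀ t ∈ L, t.1 ∈ Submodule.span ℂ {(1 : Hol W)}) ∨ ∃ y, (mon W 1, y) ∈ L) :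
    ∃ ξ : SFun W, IsForm1 ((L.map (gauge ξ)).map (evenHom W)) ∨
      IsForm2 ((L.map (gauge ξ)).map (evenHom W)) ∨
      IsForm3 ((L.map (gauge ξ)).map (evenHom W)) := by
  rcases hF with hF | ⟨y, hy⟩
  · refine ⟨-x, Or.inl (isForm1_of_mem hW (hL.map_gauge _) ?_ (map_gauge_fst_mem hF _))⟩
    have h := gauge_mem_map_gauge (-x) h1
    rwa [mulBy_one, add_neg_cancel] at h
  · obtain ⟨ξ, κ, hκ, h1', hz'⟩ := exists_gauge hW hL h1 hy
    refine ⟨ξ, Or.inr ?_⟩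
    rcases fst_mem_span hW (hL.map_gauge ξ) h1' hz' with hF | ⟨hF, ζ, hζ⟩
    · exact Or.inl (isForm2_of_mem hW (hL.map_gauge _) h1' hκ hz' hF)
    · exact Or.inr (isForm3_of_mem hW (hL.map_gauge _) h1' hκ hz' hζ hF)

/-! ### Straightening vector fields -/

theorem ddz_mul_inv {u i : Hol U} (hi : u * i = 1) (g : Hol U) :
    ddz U (g * i) = i * i * (u * ddz U g - g * ddz U u) := by
  have h := congrArg (ddz U) hi
  rw [Derivation.leibniz, Derivation.map_one_eq_zero, smul_eq_mul, smul_eq_mul] at h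
  rw [Derivation.leibniz, smul_eq_mul, smul_eq_mul]
  linear_combination (g * i) * h - (g * ddz U i + i * ddz U g) * hi

/-- An eigenvector of `T` on the quotient of the invariant subspace `F` by the line spanned by a
vector `v` of the kernel. -/
theorem exists_eigenvector_mod {E : Type*} [AddCommGroup E] [Module ℂ E] (T : Module.End ℂ E)
    (F : Submodule ℂ E) [FiniteDimensional ℂ F] (hTF : ∀ f ∈ F, T f ∈ F) {v : E} (hv : v ∈ F)
    (hTv : T v = 0) (hle : ¬ F ≤ Submodule.span ℂ {v}) :
    ∃ w ∈ F, (∀ c : ℂ, w ≠ c • v) ∧ ∃ lam c : ℂ, T w = lam • w + c • v := by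
  let K : Submodule ℂ F := Submodule.span ℂ {⟨v, hv⟩}
  have hK : K ≤ K.comap (T.restrict hTF) := by
    rw [Submodule.span_le, Set.singleton_subset_iff]
    have : (T.restrict hTF) ⟨v, hv⟩ = 0 := Subtype.ext hTv
    rw [SetLike.mem_coe, Submodule.mem_comap, this]
    exact K.zero_mem
  have hKtop : K ≠ ⊤ := by
    intro h
    refine hle fun f hf => ?_
    have hfK : (⟨f, hf⟩ : F) ∈ K := h ▸ Submodule.mem_top
    obtain ⟨c, hc⟩ := Submodule.mem_span_singleton.1 hfK
    exact Submodule.mem_span_singleton.2 ⟨c, congrArg Subtype.val hc⟩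
  have hnt : Nontrivial (F ⧸ K) := Submodule.Quotient.nontrivial_iff.2 hKtop
  let Tq : Module.End ℂ (F ⧸ K) := K.mapQ K (T.restrict hTF) hK
  obtain ⟨lam, hlam⟩ := Module.End.exists_eigenvalue Tq
  obtain ⟨u, hu⟩ := hlam.exists_hasEigenvector
  obtain ⟨⟨w, hw⟩, rfl⟩ := K.mkQ_surjective u
  refine ⟨w, hw, fun c hc => hu.2 ?_, lam, ?_⟩
  · rw [Submodule.mkQ_apply, Submodule.Quotient.mk_eq_zero]
    exact Submodule.mem_span_singleton.2 ⟨c, Subtype.ext hc.symm⟩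
  · have h1 := hu.apply_eq_smul
    have h2 : K.mkQ ((T.restrict hTF) ⟨w, hw⟩ - lam • ⟨w, hw⟩) = 0 := by
      rw [map_sub, map_smul, ← h1, sub_eq_zero]
      rfl
    rw [Submodule.mkQ_apply, Submodule.Quotient.mk_eq_zero] at h2
    obtain ⟨c, hc⟩ := Submodule.mem_span_singleton.1 h2
    have h3 : c • v = T w - lam • w := congrArg Subtype.val hc
    exact ⟨c, by rw [h3]; abel⟩

/-- Let `F` be a finite-dimensional Lie algebra of vector fields `f ∂_z` which contains a
non-vanishing one. Then some `f₁ ∈ F` and some coordinate `φ` satisfy `f₁ ∂_z = ∂_φ`, and moreover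
`φ ∂_φ ∈ F` unless `F` is one-dimensional. -/
theorem exists_straightening (hU : IsPreconnected (U : Set ℂ)) (hprim : HasPrimitives U)
    (F : Submodule ℂ (Hol U)) [FiniteDimensional ℂ F]
    (hF : ∀ f ∈ F, ∀ g ∈ F, f * ddz U g - g * ddz U f ∈ F) {f₀ : Hol U} (h₀ : f₀ ∈ F)
    (hu : IsUnit f₀) :
    ∃ φ f₁ : Hol U, f₁ ∈ F ∧ ddz U φ * f₁ = 1 ∧
      (F ≤ Submodule.span ℂ {f₁} ∨ φ * f₁ ∈ F) := by
  obtain ⟨i, hi⟩ := hu.exists_right_inv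
  by_cases hle : F ≤ Submodule.span ℂ {f₀}
  · obtain ⟨φ, hφ⟩ := hprim i
    exact ⟨φ, f₀, h₀, by rw [hφ, mul_comm, hi], Or.inl hle⟩
  let T : Module.End ℂ (Hol U) :=
    LinearMap.mulLeft ℂ f₀ ∘ₗ (ddz U : Hol U →ₗ[ℂ] Hol U) - LinearMap.mulRight ℂ (ddz U f₀)
  have hT : ∀ f, T f = f₀ * ddz U f - f * ddz U f₀ := fun f => rfl
  have hTF : ∀ f ∈ F, T f ∈ F := fun f hf => hF f₀ h₀ f hf
  obtain ⟨f₂, h₂, hf₂, lam, c, hc⟩ := exists_eigenvector_mod (E := Hol U) T F hTF h₀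
    (by rw [hT, mul_comm, sub_self]) hle
  rw [hT] at hc
  rcases eq_or_ne lam 0 with rfl | hlam0
  -- For `lam = 0` the quotient rule reads `(f₂/f₀)' = c/f₀`. So `c = 0` would make `f₂` a multiple
  -- of `f₀`, and otherwise `φ = f₂/(c f₀)` straightens `f₀`.
  · have hc0 : c ≠ 0 := by
      rintro rfl
      obtain ⟨k, hk⟩ := exists_eq_smul_one_of_ddz_eq_zero hU (f := f₂ * i) (by
        rw [ddz_mul_inv hi, hc]; simp)
      refine hf₂ k ?_
      calc f₂ = f₂ * i * f₀ := by rw [mul_assoc, mul_comm i, hi, mul_one]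
        _ = k • f₀ := by rw [hk, smul_mul_assoc, one_mul]
    refine ⟨c⁻¹ • (f₂ * i), f₀, h₀, ?_, Or.inr ?_⟩
    · rw [Derivation.map_smul, ddz_mul_inv hi, hc, zero_smul, zero_add, mul_smul_comm, smul_smul,
        inv_mul_cancel₀ hc0, one_smul]
      linear_combination (f₀ * i + 1) * hi
    · rw [smul_mul_assoc, mul_assoc, mul_comm i, hi, mul_one]
      exact F.smul_mem _ h₂
  -- For `lam ≠ 0` this shift is a genuine eigenvector of `ad f₀`. Then `f₁/f₀` is a nonzero
  -- multiple of `e^{lam ψ}` with `ψ' = 1/f₀`, so `f₁` never vanishes.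
  · set f₁ := f₂ + (c / lam) • f₀ with hf₁
    have h₁ : f₁ ∈ F := F.add_mem h₂ (F.smul_mem _ h₀)
    have hf₁0 : f₁ ≠ 0 := fun h => hf₂ (-(c / lam)) (by
      rw [neg_smul]; exact eq_neg_of_add_eq_zero_left h)
    have hbr : f₀ * ddz U f₁ - f₁ * ddz U f₀ = lam • f₁ := by
      rw [hf₁, map_add, Derivation.map_smul, smul_add, smul_smul, mul_div_cancel₀ _ hlam0, ← hc]
      simp only [mul_add, add_mul, mul_smul_comm, smul_mul_assoc, mul_comm f₀ (ddz U f₀)]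
      abel
    obtain ⟨ψ, hψ⟩ := hprim i
    have hunit : IsUnit f₁ := by
      obtain ⟨k, hk⟩ := exists_eq_smul_one_of_ddz_eq_zero hU
        (f := (f₁ * i) * Hol.exp (-(lam • ψ))) (by
          rw [Derivation.leibniz, ddz_exp, ddz_mul_inv hi, hbr, map_neg, Derivation.map_smul, hψ]
          simp only [smul_eq_mul, Algebra.smul_def]
          ring)
      have hk0 : k ≠ 0 := by
        rintro rfl
        rw [zero_smul] at hk
        have h1 := (isUnit_exp (-(lam • ψ))).mul_left_eq_zero.1 hk
        have hi' : IsUnit i := IsUnit.of_mul_eq_one f₀ (by rw [mul_comm, hi])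
        exact hf₁0 (hi'.mul_left_eq_zero.1 h1)
      refine isUnit_of_mul_isUnit_left (y := i * Hol.exp (-(lam • ψ))) ?_
      rw [← mul_assoc, hk, ← Algebra.algebraMap_eq_smul_one]
      exact (IsUnit.mk0 k hk0).map (algebraMap ℂ (Hol U))
    obtain ⟨j, hj⟩ := hunit.exists_right_inv
    -- The coordinate is `φ = -f₀/(lam f₁)`, so that `φ f₁` is a multiple of `f₀` and lies in `F`.
    refine ⟨(-lam⁻¹) • (f₀ * j), f₁, h₁, ?_, Or.inr ?_⟩
    · have hbr' : f₁ * ddz U f₀ - f₀ * ddz U f₁ = (-lam) • f₁ := by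
        rw [neg_smul, ← hbr]; abel
      rw [Derivation.map_smul, ddz_mul_inv hj, hbr', mul_smul_comm, smul_smul, neg_mul_neg,
        inv_mul_cancel₀ hlam0, one_smul]
      linear_combination (f₁ * j + 1) * hj
    · rw [smul_mul_assoc, mul_assoc, mul_comm j, hj, mul_one]
      exact F.smul_mem _ h₀

/-- A function with prescribed logarithmic derivative. -/
theorem exists_unit_ddz_eq (hW : HasPrimitives W) (ξ : Hol W) :
    ∃ β : (Hol W)ˣ, ddz W (β : Hol W) = ξ * β := by
  obtain ⟨ψ, hψ⟩ := hW ξ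
  refine ⟨(isUnit_exp ψ).unit, ?_⟩
  rw [IsUnit.unit_spec, ddz_exp, hψ]

theorem isForm0_of_forall (N : Submodule ℂ (Module.End ℂ (SFun W))) [FiniteDimensional ℂ N]
    (hN : ∀ T ∈ N, ∃ g h : Hol W, T = aOp g h) : IsForm0 N := by
  let b := Module.finBasis ℂ N
  choose g h hgh using fun i => hN _ (b i).2
  have hfun : (fun i => aOp (g i) (h i)) = N.subtype ∘ b := funext fun i => (hgh i).symm
  refine ⟨Module.finrank ℂ N, g, h, ?_, ?_⟩
  · rw [hfun]
    exact b.linearIndependent.map' N.subtype N.ker_subtype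
  · rw [hfun, Set.range_comp, ← Submodule.map_span, b.span_eq, Submodule.map_top,
      Submodule.range_subtype]

/-- If an open set contained no regular point, a nonzero vector field part would vanish on it, hence
on all of the connected set `U`. -/
theorem dense_isRegularPoint (hU : IsPreconnected (U : Set ℂ))
    (l : LieSubalgebra ℂ (Module.End ℂ (SFun U))) : Dense {p : U | IsRegularPoint l p} := by
  by_cases hall : ∀ f g h : Hol U, evenOp f g h ∈ l → f = 0
  · have : {p : U | IsRegularPoint l p} = Set.univ := Set.eq_univ_of_forall fun p => Or.inl hall
    rw [this]
    exact dense_univ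
  push Not at hall
  obtain ⟨f, g, h, hl, hf⟩ := hall
  rw [dense_iff_inter_open]
  rintro O hO ⟨q, hq⟩
  by_contra hne
  refine hf (Hol.ext' fun z => ?_)
  have hzero : ∀ z ∈ O, f.1 z = 0 := by
    intro z hz
    by_contra hz0
    exact hne ⟨z, hz, Or.inr ⟨f, g, h, hl, hz0⟩⟩
  have hev : ext0 f.1 =ᶠ[nhds (q : ℂ)] 0 := by
    rw [← U.isOpenEmbedding'.map_nhds_eq q]
    refine Filter.eventually_map.2 ?_
    filter_upwards [hO.mem_nhds hq] with z hz
    rw [ext0_apply, hzero z hz]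
    rfl
  have h1 := f.2.eqOn_zero_of_preconnected_of_eventuallyEq_zero hU q.2 hev z.2
  rw [ext0_apply] at h1
  exact h1

/-- Near a point where some vector field part does not vanish there is a coordinate in which the
vector field parts contain `∂_z`, and contain also `z ∂_z` unless they are multiples of `∂_z`. -/
theorem exists_transf_straightening {L : Submodule ℂ (Coeffs U)} [FiniteDimensional ℂ L]
    (hL : LieClosed L) {t₀ : Coeffs U} (ht₀ : t₀ ∈ L) (p : U) (hp : t₀.1.1 p ≠ 0) :
    ∃ (V W : Opens ℂ) (hVU : V ≤ U) (Φ : Transf V W), (p : ℂ) ∈ V ∧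
      (∃ c r, 0 < r ∧ (W : Set ℂ) = Metric.ball c r) ∧
      (∃ x, ((1 : Hol W), x) ∈ L.map (Φ.transport hVU)) ∧
      ((∀ t ∈ L.map (Φ.transport hVU), t.1 ∈ Submodule.span ℂ {(1 : Hol W)}) ∨
        ∃ y, (mon W 1, y) ∈ L.map (Φ.transport hVU)) := by
  have hopen : IsOpen ((U : Set ℂ) ∩ ext0 t₀.1.1 ⁻¹' {0}ᶜ) :=
    AnalyticOnNhd.continuousOn t₀.1.2 |>.isOpen_inter_preimage U.isOpen isOpen_compl_singleton
  have hpmem : (p : ℂ) ∈ (U : Set ℂ) ∩ ext0 t₀.1.1 ⁻¹' {0}ᶜ :=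
    ⟨p.2, by rw [Set.mem_preimage, ext0_apply]; exact hp⟩
  obtain ⟨ρ, hρ, hball⟩ := Metric.isOpen_iff.1 hopen p hpmem
  set B : Opens ℂ := ⟨Metric.ball p ρ, Metric.isOpen_ball⟩
  have hBU : B ≤ U := fun z hz => (hball hz).1
  have hpB : (p : ℂ) ∈ B := Metric.mem_ball_self hρ
  set F : Submodule ℂ (Hol B) :=
    L.map ((resHom hBU).toLinearMap ∘ₗ LinearMap.fst ℂ (Hol U) (SFun U))
  have hmemF : ∀ t ∈ L, res hBU t.1 ∈ F := fun t ht => ⟨t, ht, rfl⟩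
  have hF : ∀ f ∈ F, ∀ g ∈ F, f * ddz B g - g * ddz B f ∈ F := by
    rintro _ ⟨s, hs, rfl⟩ _ ⟨t, ht, rfl⟩
    refine ⟨_, hL s hs t ht, ?_⟩
    change res hBU (s.1 * ddz U t.1 - t.1 * ddz U s.1) =
      res hBU s.1 * ddz B (res hBU t.1) - res hBU t.1 * ddz B (res hBU s.1)
    rw [res_sub, res_mul, res_mul, ddz_res, ddz_res]
  have hunit : IsUnit (res hBU t₀.1) := isUnit_of_forall_ne_zero fun z => by
    have h1 := (hball z.2).2
    rw [res_apply, ← ext0_apply t₀.1.1]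
    exact h1
  obtain ⟨φ, f₁, h₁, hφ, hcase⟩ := exists_straightening (U := B)
    (convex_ball (p : ℂ) ρ).isPreconnected (hasPrimitives_of_ball rfl) F hF (hmemF t₀ ht₀) hunit
  have hdφ : (ddz B φ).1 ⟨p, hpB⟩ ≠ 0 :=
    apply_ne_zero_of_isUnit (IsUnit.of_mul_eq_one f₁ hφ) _
  obtain ⟨V, W, hVB, Φ, hpV, hW, hΦ⟩ := exists_transf φ ⟨p, hpB⟩ hdφ
  -- Since `φ' f₁ = 1`, the field `g f₁ ∂_z` becomes `g ∂_φ`. Thus `f₁` goes to `1` and `φ f₁` to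
  -- the new variable.
  have hfst : ∀ (t : Coeffs U) (g : Hol B), res hBU t.1 = g * f₁ →
      (Φ.transport (hVB.trans hBU) t).1 = Φ.compEquiv.symm (res hVB g) := by
    intro t g hg
    rw [Φ.transport_apply, hΦ, ddz_res, ← res_res hBU hVB, hg, ← res_mul]
    have hgφ : ddz B φ * (g * f₁) = g := by linear_combination g * hφ
    rw [hgφ]
  refine ⟨V, W, hVB.trans hBU, Φ, hpV, hW, ?_, ?_⟩
  · obtain ⟨t, ht, htf⟩ := h₁
    refine ⟨(Φ.transport _ t).2, ⟨t, ht, Prod.ext ?_ rfl⟩⟩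
    rw [hfst t 1 (by rw [one_mul]; exact htf), ← resHom_apply, map_one, map_one]
  · rcases hcase with hcase | ⟨t, ht, htf⟩
    · left
      rintro _ ⟨t, ht, rfl⟩
      obtain ⟨c, hc⟩ := Submodule.mem_span_singleton.1 (hcase (hmemF t ht))
      rw [hfst t (c • 1) (by rw [smul_mul_assoc, one_mul, hc]), ← resHom_apply, map_smul, map_one,
        map_smul, map_one]
      exact Submodule.smul_mem _ _ (Submodule.mem_span_singleton_self _)
    · right
      refine ⟨(Φ.transport _ t).2, ⟨t, ht, Prod.ext ?_ rfl⟩⟩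
      rw [hfst t φ htf, ← hΦ, ← Φ.comp_mon_one, Φ.symm_comp]

end EvenOps

end

open EvenOps

/-! ### Assembly of the local normal forms -/

theorem mainTheorem1 (U : TopologicalSpace.Opens ℂ) (hU : IsConnected (U : Set ℂ))
    (l : LieSubalgebra ℂ (Module.End ℂ (EvenOps.SFun U))) (hl : l ≤ EvenOps.d10 U)
    (hfin : FiniteDimensional ℂ l) :
    Dense {p : U | EvenOps.IsRegularPoint l p} ∧
    ∀ p : U, EvenOps.IsRegularPoint l p →
      ∃ (V W : TopologicalSpace.Opens ℂ) (hVU : V ≤ U) (Φ : EvenOps.Transf V W)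
        (N : Submodule ℂ (Module.End ℂ (EvenOps.SFun W))),
        (p : ℂ) ∈ V ∧ Φ.CarriesAlgebra hVU l N ∧
        (EvenOps.IsForm0 N ∨ EvenOps.IsForm1 N ∨ EvenOps.IsForm2 N ∨ EvenOps.IsForm3 N) := by
  refine ⟨dense_isRegularPoint hU.isPreconnected l, fun p hp => ?_⟩
  have hLfin := finiteDimensional_coeffsOf l
  rcases hp with hzero | ⟨f, g, h, hfl, hfp⟩
  -- Without vector field parts no straightening is needed: the coordinate `z` itself and trivial
  -- factors suffice.
  · obtain ⟨V, W, hVU, Φ, hpV, -, -⟩ := exists_transf (mon U 1) p (by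
      rw [ddz_mon_one]; exact one_ne_zero)
    refine ⟨V, W, hVU, Φ.withFactors 1 1, _, hpV,
      Φ.carriesAlgebra_withFactors hVU (ξ := 0) (by simp) (by simp) l,
      Or.inl (isForm0_of_forall _ ?_)⟩
    rintro _ ⟨_, ⟨_, ⟨t, ht, rfl⟩, rfl⟩, rfl⟩
    refine ⟨(gauge 0 (Φ.transport hVU t)).2.1, (gauge 0 (Φ.transport hVU t)).2.2, ?_⟩
    have h0 : (gauge 0 (Φ.transport hVU t)).1 = 0 := by
      change Φ.compEquiv.symm (ddz V Φ.φ * res hVU t.1) = 0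
      rw [hzero _ _ _ ht, ← resHom_apply, map_zero, mul_zero, map_zero]
    rw [evenHom_apply, h0, aOp]
  · obtain ⟨V, W, hVU, Φ, hpV, ⟨c, r, hr, hball⟩, ⟨x, hx⟩, hF⟩ :=
      exists_transf_straightening (lieClosed_coeffsOf l) (t₀ := (f, g, h)) hfl p hfp
    have hW : IsConnected (W : Set ℂ) := by
      rw [hball]
      exact (convex_ball c r).isConnected ⟨c, Metric.mem_ball_self hr⟩
    obtain ⟨ξ, hξ⟩ :=
      exists_gauge_isForm hW ((lieClosed_coeffsOf l).map_transport Φ hVU) hx hF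
    -- The gauge vector `ξ` is realised by integrating it on the ball `W` to a rescaling of `θ` and
    -- a gauge factor.
    obtain ⟨β, hβ⟩ := exists_unit_ddz_eq (hasPrimitives_of_ball hball) ξ.1
    obtain ⟨α, hα⟩ := exists_unit_ddz_eq (hasPrimitives_of_ball hball) (-ξ.2)
    exact ⟨V, W, hVU, Φ.withFactors β α, _, hpV,
      Φ.carriesAlgebra_withFactors hVU hβ (by rw [hα]; ring) l, Or.inr hξ⟩
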